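/- Let $\mathbb{F}$ be $\mathbb{R}$ or $\mathbb{C}$. A \emph{presentation} $\mathcal{B}^\#$ of a Banach space $\mathcal{B}$ over $\mathbb{F}$ is a sequence $(v_j)_{j\in\mathbb{N}}$ in $\mathcal{B}$ whose $\mathbb{F}$-linear span is dense in $\mathcal{B}$. Fix a standard effective coding of the formal finite sums $\sum_{j<k}\alpha_j \overline{v_j}$ with rational scalars $\alpha_j\in\mathbb{F}\cap\mathbb{Q}(i)$, let $\mathcal{R}(\mathcal{B}^\#;m)\in\mathcal{B}$ be the value of the $m$-th such sum at $\overline{v_j}=v_j$, and let $I_n\subseteq\mathbb{R}$ be the $n$-th open interval with rational centre and positive rational radius in a standard effective coding. The \emph{diagram} of $\mathcal{B}^\#$ is the set of all pairs $(m,n)\in\mathbb{N}^2$ with $\|\mathcal{R}(\mathcal{B}^\#;m)\|\in I_n$, regarded as a subset of $\mathbb{N}$ through the standard pairing function. A \emph{name} of $\mathcal{B}^\#$ is a function $f\in\mathbb{N}^{\mathbb{N}}$ whose range is the diagram of $\mathcal{B}^\#$. A set $P\subseteq\mathbb{N}^{\mathbb{N}}$ is $\Pi^0_2$ if there is a computable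 predicate $Q\subseteq\mathbb{N}^{\mathbb{N}}\times\mathbb{N}^2$ such that for all $f$, $f\in P$ if and only if $\forall x\,\exists y\,Q(f;x,y)$. A set $A\subseteq\mathbb{N}^{\mathbb{N}}$ is \emph{$\Pi^0_2$-complete} if it is $\Pi^0_2$ and for every $\Pi^0_2$ set $P\subseteq\mathbb{N}^{\mathbb{N}}$ there is a (total) computable operator $F:\mathbb{N}^{\mathbb{N}}\to\mathbb{N}^{\mathbb{N}}$ such that for all $f$, $f\in P$ if and only if $F(f)\in A$. \textbf{Theorem.} For each of $\mathbb{F}=\mathbb{R}$ and $\mathbb{F}=\mathbb{C}$, the set of all names of presentations of $\ell^2$ (the square-summable sequences over $\mathbb{F}$) is $\Pi^0_2$-complete, and for each $n\geq 1$ the set of all names of presentations of $\ell^2_n$ (that is, $\mathbb{F}^n$ with the Euclidean norm) is $\Pi^0_2$-complete. -/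

import Mathlib

/-! ### Computability on Baire space -/

/-- The partial recursive functionals `Φ : ℕ^ℕ × ℕ ⇀ ℕ` (Kleene): the least class that contains the
basic functions and the evaluation `(f, n) ↦ f n` of the oracle, and is closed under pairing,
composition, primitive recursion and unbounded search. A derivation is an oracle program; the same
program is run on every oracle `f`. -/
inductive PartrecFunctional : ((ℕ → ℕ) → ℕ →. ℕ) → Prop
  | zero : PartrecFunctional fun _ _ => Part.some 0
  | succ : PartrecFunctional fun _ n => Part.some (n + 1)
  | left : PartrecFunctional fun _ n => Part.some n.unpair.1
  | right : PartrecFunctional fun _ n => Part.some n.unpair.2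
  | oracle : PartrecFunctional fun f n => Part.some (f n)
  | pair {Φ Ψ : (ℕ → ℕ) → ℕ →. ℕ} (hΦ : PartrecFunctional Φ) (hΨ : PartrecFunctional Ψ) :
      PartrecFunctional fun f n => Nat.pair <$> Φ f n <*> Ψ f n
  | comp {Φ Ψ : (ℕ → ℕ) → ℕ →. ℕ} (hΦ : PartrecFunctional Φ) (hΨ : PartrecFunctional Ψ) :
      PartrecFunctional fun f n => Ψ f n >>= Φ f
  | prec {Φ Ψ : (ℕ → ℕ) → ℕ →. ℕ} (hΦ : PartrecFunctional Φ) (hΨ : PartrecFunctional Ψ) :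
      PartrecFunctional fun f p =>
        p.unpair.2.rec (Φ f p.unpair.1) fun y IH =>
          IH >>= fun i => Ψ f (Nat.pair p.unpair.1 (Nat.pair y i))
  | rfind {Φ : (ℕ → ℕ) → ℕ →. ℕ} (hΦ : PartrecFunctional Φ) :
      PartrecFunctional fun f a =>
        Nat.rfind fun n => (fun m => decide (m = 0)) <$> Φ f (Nat.pair a n)

/-- A (total) computable operator `F : ℕ^ℕ → ℕ^ℕ`. -/
def ComputableOperator (F : (ℕ → ℕ) → ℕ → ℕ) : Prop :=
  PartrecFunctional fun f n => Part.some (F f n)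

/-- A computable predicate `Q ⊆ ℕ^ℕ × ℕ²`: its characteristic function is computable. -/
def ComputablePredicate (Q : (ℕ → ℕ) → ℕ → ℕ → Prop) : Prop :=
  ∃ χ : (ℕ → ℕ) → ℕ → ℕ, ComputableOperator χ ∧
    ∀ f x y, (Q f x y → χ f (Nat.pair x y) = 1) ∧ (¬ Q f x y → χ f (Nat.pair x y) = 0)

/-- The (lightface) class `Π⁰₂` of subsets of Baire space. -/
def IsPi02 (P : Set (ℕ → ℕ)) : Prop :=
  ∃ Q : (ℕ → ℕ) → ℕ → ℕ → Prop, ComputablePredicate Q ∧ ∀ f, f ∈ P ↔ ∀ x, ∃ y, Q f x y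

/-- `A` is `Π⁰₂`-complete: it is `Π⁰₂`, and every `Π⁰₂` set is the preimage of `A` under a
computable operator. -/
def IsPi02Complete (A : Set (ℕ → ℕ)) : Prop :=
  IsPi02 A ∧ ∀ P : Set (ℕ → ℕ), IsPi02 P →
    ∃ F : (ℕ → ℕ) → ℕ → ℕ, ComputableOperator F ∧ ∀ f, f ∈ P ↔ F f ∈ A

/-! ### Codes of rational scalars and rational intervals -/

/-- The rational number with code `⟨⟨a, b⟩, c⟩`, namely `(a - b) / (c + 1)`. -/
def ratOfCode (k : ℕ) : ℚ :=
  ((k.unpair.1.unpair.1 : ℚ) - (k.unpair.1.unpair.2 : ℚ)) / ((k.unpair.2 : ℚ) + 1)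

/-- The positive rational number with code `⟨a, b⟩`, namely `(a + 1) / (b + 1)`. -/
def posRatOfCode (k : ℕ) : ℚ :=
  ((k.unpair.1 : ℚ) + 1) / ((k.unpair.2 : ℚ) + 1)

/-- The coding of the rational scalars of `ℝ`. -/
noncomputable def realScalar (k : ℕ) : ℝ := (ratOfCode k : ℝ)

/-- The coding of the rational scalars of `ℂ`, the elements of `ℚ(i)`. -/
noncomputable def complexScalar (k : ℕ) : ℂ :=
  (ratOfCode k.unpair.1 : ℂ) + (ratOfCode k.unpair.2 : ℂ) * Complex.I

/-- `I_n`, the `n`-th rational open ball of the real line: a rational centre and a positive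
rational radius. -/
noncomputable def ratInterval (n : ℕ) : Set ℝ :=
  Metric.ball (ratOfCode n.unpair.1 : ℝ) (posRatOfCode n.unpair.2 : ℝ)

/-! ### Presentations, diagrams and names -/

/-- A presentation of a Banach space `B`: a sequence of vectors (the distinguished points) whose
linear span is dense in `B`. -/
structure Presentation (𝕜 B : Type*) [RCLike 𝕜] [NormedAddCommGroup B] [NormedSpace 𝕜 B] where
  point : ℕ → B
  linearlyDense : (Submodule.span 𝕜 (Set.range point)).topologicalClosure = ⊤

namespace Presentation

variable {𝕜 B : Type*} [RCLike 𝕜] [NormedAddCommGroup B] [NormedSpace 𝕜 B]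

/-- The `m`-th rational vector: if `m` is the code of the list `[c₀, …, c_{k-1}]` of codes of
scalars `σ c₀, …, σ c_{k-1}`, it is `∑_{j < k} (σ c_j) v_j`, with `v_j` the distinguished points. -/
noncomputable def ratVector (σ : ℕ → 𝕜) (S : Presentation 𝕜 B) (m : ℕ) : B :=
  ∑ j ∈ Finset.range (Denumerable.ofNat (List ℕ) m).length,
    σ ((Denumerable.ofNat (List ℕ) m).getD j 0) • S.point j

/-- The diagram: the set of (codes of) pairs `(m, n)` such that the norm of the `m`-th rational
vector belongs to the `n`-th rational interval. -/
def diagram (σ : ℕ → 𝕜) (S : Presentation 𝕜 B) : Set ℕ :=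
  {k | ‖S.ratVector σ k.unpair.1‖ ∈ ratInterval k.unpair.2}

/-- `f` is a name of the presentation: it enumerates the diagram. -/
def IsName (σ : ℕ → 𝕜) (S : Presentation 𝕜 B) (f : ℕ → ℕ) : Prop :=
  Set.range f = S.diagram σ

end Presentation

/-- The set of all names of presentations of the real Banach space `B`. -/
def realNames (B : Type*) [NormedAddCommGroup B] [NormedSpace ℝ B] : Set (ℕ → ℕ) :=
  {f | ∃ S : Presentation ℝ B, S.IsName realScalar f}

/-- The set of all names of presentations of the complex Banach space `B`. -/
def complexNames (B : Type*) [NormedAddCommGroup B] [NormedSpace ℂ B] : Set (ℕ → ℕ) :=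
  {f | ∃ S : Presentation ℂ B, S.IsName complexScalar f}

/-! Upper bound. Let `e` be the standard basis, padded with zeros in finite dimension. A function
`f` is a name exactly when three conditions hold. (1) `Set.range f` is a cut (`IsCut`): it locates
every norm to any precision, and it is rounded and closed under enlarging intervals. (2) Every
finite part of `Set.range f` is realized by finitely many rational combinations of `e`. (3) Every
finite part of the diagram of `e` is realized by rational vectors of the presentation that `f`
describes. Each condition asks, for each finite stage, for a finite witness that a prefix of `f`
confirms, so each is `Π⁰₂`.

Necessity follows from density of the rational vectors and openness of the intervals
(`ScalarCoding.exists_comb`). For sufficiency, (2) gives sequences that satisfy more and more of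
`Set.range f`. An ultralimit of their inner products (`IsCut.exists_hilbertSpace`), or of the
vectors themselves in finite dimension (`IsCut.exists_of_properSpace`), yields a sequence compatible
with the cut, whose diagram must then be the cut (`IsCut.eq_seqDiagram`). Condition (3) and
compactness put isometric copies of orthonormal families into every finite-dimensional candidate
(`ScalarCoding.le_finrank`). This excludes finite dimension for `ℓ²`, and makes the sequence span
all of `𝕜ⁿ` in the other case.

Hardness. In the standard presentation, squared norms of rational vectors are rational, so the
diagram is decidable. Given `∀ x ∃ y Q`, an entry `k` is emitted only once witnesses are found for
all `x ≤ k` (`IsPi02.exists_reduction`). If the property fails, the output has finite range, whereas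
every diagram is infinite. -/

/-! ### Bounded quantification of primitive recursive predicates -/

namespace PrimrecPred

variable {α β : Type*} [Primcodable α] [Primcodable β]

theorem bex_mem {L : α → List β} {R : α → β → Prop} (hL : Primrec L) (hR : PrimrecRel R) :
    PrimrecPred fun a => ∃ b ∈ L a, R a b :=
  PrimrecRel.comp hR.swap.exists_mem_list hL Primrec.id

theorem ball_mem {L : α → List β} {R : α → β → Prop} (hL : Primrec L) (hR : PrimrecRel R) :
    PrimrecPred fun a => ∀ b ∈ L a, R a b :=
  PrimrecRel.comp hR.swap.forall_mem_list hL Primrec.id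

theorem bex_lt {m : α → ℕ} {R : α → ℕ → Prop} (hm : Primrec m) (hR : PrimrecRel R) :
    PrimrecPred fun a => ∃ b < m a, R a b :=
  (bex_mem (Primrec.list_range.comp hm) hR).of_eq (by simp)

theorem ball_lt {m : α → ℕ} {R : α → ℕ → Prop} (hm : Primrec m) (hR : PrimrecRel R) :
    PrimrecPred fun a => ∀ b < m a, R a b :=
  (ball_mem (Primrec.list_range.comp hm) hR).of_eq (by simp)

end PrimrecPred

/-! ### Closure properties of computable operators -/

namespace PartrecFunctional

theorem of_partrec {g : ℕ →. ℕ} (hg : Nat.Partrec g) : PartrecFunctional fun _ n => g n := by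
  induction hg with
  | zero => exact zero
  | succ => exact succ
  | left => exact left
  | right => exact right
  | pair _ _ h₁ h₂ => exact pair h₁ h₂
  | comp _ _ h₁ h₂ => exact comp h₁ h₂
  | prec _ _ h₁ h₂ => exact prec h₁ h₂
  | rfind _ h => exact rfind h

end PartrecFunctional

namespace ComputableOperator

variable {F G : (ℕ → ℕ) → ℕ → ℕ}

theorem of_primrec {g : ℕ → ℕ} (hg : Primrec g) : ComputableOperator fun _ => g :=
  PartrecFunctional.of_partrec (Nat.Partrec.of_primrec (Primrec.nat_iff.1 hg))

theorem oracle : ComputableOperator fun f => f := PartrecFunctional.oracle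

theorem comp (hF : ComputableOperator F) (hG : ComputableOperator G) :
    ComputableOperator fun f n => F f (G f n) := by
  have := PartrecFunctional.comp hF hG
  simpa [ComputableOperator] using this

theorem pair (hF : ComputableOperator F) (hG : ComputableOperator G) :
    ComputableOperator fun f n => Nat.pair (F f n) (G f n) := by
  have := PartrecFunctional.pair hF hG
  simpa [ComputableOperator, Seq.seq] using this

theorem primrec_comp {g : ℕ → ℕ} (hg : Primrec g) (hG : ComputableOperator G) :
    ComputableOperator fun f n => g (G f n) :=
  (of_primrec hg).comp hG

theorem comp_primrec {g : ℕ → ℕ} (hF : ComputableOperator F) (hg : Primrec g) :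
    ComputableOperator fun f n => F f (g n) :=
  hF.comp (of_primrec hg)

theorem prec (hF : ComputableOperator F) (hG : ComputableOperator G) :
    ComputableOperator fun f p =>
      p.unpair.2.rec (F f p.unpair.1)
        fun y i => G f (Nat.pair p.unpair.1 (Nat.pair y i)) := by
  have := PartrecFunctional.prec hF hG
  unfold ComputableOperator
  refine (congrArg PartrecFunctional ?_).mp this
  funext f p
  dsimp only
  -- Every stage of the recursion in `Part` is a defined value, so it agrees with the total
  -- recursion.
  induction p.unpair.2 with
  | zero => rfl
  | succ y ih =>
    dsimp only at ih ⊢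
    rw [ih]
    simp

/-- The finite prefixes of a computable operator are computable. -/
theorem map_range (hF : ComputableOperator F) :
    ComputableOperator fun f n => Encodable.encode ((List.range n).map (F f)) := by
  have happ : Primrec fun q : ℕ => Encodable.encode
      (Denumerable.ofNat (List ℕ) q.unpair.1 ++ [q.unpair.2]) :=
    Primrec.encode.comp (Primrec.list_concat.comp
      ((Primrec.ofNat (List ℕ)).comp (Primrec.fst.comp Primrec.unpair))
      (Primrec.snd.comp Primrec.unpair))
  have h2 : Primrec fun q : ℕ => q.unpair.2.unpair.2 :=
    (Primrec.snd.comp Primrec.unpair).comp (Primrec.snd.comp Primrec.unpair)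
  have h1 : Primrec fun q : ℕ => q.unpair.2.unpair.1 :=
    (Primrec.fst.comp Primrec.unpair).comp (Primrec.snd.comp Primrec.unpair)
  have hstep := primrec_comp happ ((of_primrec h2).pair (hF.comp_primrec h1))
  have := (prec (of_primrec (Primrec.const (Encodable.encode ([] : List ℕ)))) hstep).comp_primrec
    (g := fun n => Nat.pair 0 n) (Primrec₂.natPair.comp (Primrec.const 0) Primrec.id)
  convert this using 3 with f n
  simp only [Nat.unpair_pair]
  induction n with
  | zero => rfl
  | succ n ih =>
    rw [List.range_succ, List.map_append]
    exact congrArg Encodable.encode (congrArg (· ++ [F f n]) (by rw [← ih]; simp))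

end ComputableOperator

/-! ### `Π⁰₂` sets: prefix form, intersections and reductions -/

section Pi02

open ComputableOperator

/-- Sets defined by `∀ x ∃ s w`, with a primitive recursive matrix that sees the prefix of length
`s` of the argument. -/
theorem IsPi02.of_prefix {α β : Type*} [Denumerable α] [Denumerable β]
    {R : List ℕ → α → β → Prop}
    (hR : PrimrecPred fun p : List ℕ × α × β => R p.1 p.2.1 p.2.2) :
    IsPi02 {f | ∀ x, ∃ s w, R ((List.range s).map f) x w} := by
  classical
  let Q : (ℕ → ℕ) → ℕ → ℕ → Prop := fun f x y =>
    R ((List.range y.unpair.1).map f) (Denumerable.ofNat α x) (Denumerable.ofNat β y.unpair.2)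
  have hu1 : Primrec fun n : ℕ => n.unpair.1 := Primrec.fst.comp Primrec.unpair
  have hu2 : Primrec fun n : ℕ => n.unpair.2 := Primrec.snd.comp Primrec.unpair
  let g : ℕ → ℕ := fun q =>
    if R (Denumerable.ofNat (List ℕ) q.unpair.1) (Denumerable.ofNat α q.unpair.2.unpair.1)
      (Denumerable.ofNat β q.unpair.2.unpair.2.unpair.2) then 1 else 0
  have hg : Primrec g := by
    refine Primrec.ite (hR.comp (Primrec.pair ((Primrec.ofNat _).comp hu1) (Primrec.pair
      ((Primrec.ofNat _).comp (hu1.comp hu2))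
      ((Primrec.ofNat _).comp (hu2.comp (hu2.comp hu2)))))) (Primrec.const 1) (Primrec.const 0)
  refine ⟨Q, ⟨_, primrec_comp hg ((oracle.map_range.comp_primrec (hu1.comp hu2)).pair
    (of_primrec Primrec.id)), fun f x y => ?_⟩, fun f => ?_⟩
  · simp only [g, id, Nat.unpair_pair, Denumerable.ofNat_encode]
    exact ⟨fun h => if_pos h, fun h => if_neg h⟩
  · constructor
    · intro h x
      obtain ⟨s, w, hw⟩ := h (Denumerable.ofNat α x)
      exact ⟨Nat.pair s (Encodable.encode w), by simpa [Q] using hw⟩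
    · intro h x
      obtain ⟨y, hy⟩ := h (Encodable.encode x)
      exact ⟨_, _, by simpa [Q] using hy⟩

/-- Pairing merges the two universal variables and the two witnesses; the product of the
characteristic functions decides the conjunction. -/
theorem IsPi02.inter {P P' : Set (ℕ → ℕ)} (hP : IsPi02 P) (hP' : IsPi02 P') :
    IsPi02 (P ∩ P') := by
  obtain ⟨Q, ⟨χ, hχ, hχQ⟩, hQ⟩ := hP
  obtain ⟨Q', ⟨χ', hχ', hχQ'⟩, hQ'⟩ := hP'
  have hu1 : Primrec fun n : ℕ => n.unpair.1 := Primrec.fst.comp Primrec.unpair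
  have hu2 : Primrec fun n : ℕ => n.unpair.2 := Primrec.snd.comp Primrec.unpair
  have hm : Primrec fun n : ℕ => n.unpair.1 * n.unpair.2 := Primrec.nat_mul.comp hu1 hu2
  have h1 : Primrec fun n : ℕ => Nat.pair n.unpair.1.unpair.1 n.unpair.2.unpair.1 :=
    Primrec₂.natPair.comp (hu1.comp hu1) (hu1.comp hu2)
  have h2 : Primrec fun n : ℕ => Nat.pair n.unpair.1.unpair.2 n.unpair.2.unpair.2 :=
    Primrec₂.natPair.comp (hu2.comp hu1) (hu2.comp hu2)
  refine ⟨fun f x y => Q f x.unpair.1 y.unpair.1 ∧ Q' f x.unpair.2 y.unpair.2,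
    ⟨_, primrec_comp hm ((hχ.comp_primrec h1).pair (hχ'.comp_primrec h2)), fun f x y => ?_⟩,
    fun f => ?_⟩
  · simp only [Nat.unpair_pair]
    refine ⟨fun h => by rw [(hχQ ..).1 h.1, (hχQ' ..).1 h.2], fun h => ?_⟩
    by_cases h1 : Q f x.unpair.1 y.unpair.1
    · rw [(hχQ' ..).2 fun h2 => h ⟨h1, h2⟩, mul_zero]
    · rw [(hχQ ..).2 h1, zero_mul]
  · rw [Set.mem_inter_iff, hQ, hQ']
    constructor
    · rintro ⟨h, h'⟩ x
      obtain ⟨y, hy⟩ := h x.unpair.1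
      obtain ⟨y', hy'⟩ := h' x.unpair.2
      exact ⟨Nat.pair y y', by simpa using ⟨hy, hy'⟩⟩
    · intro h
      refine ⟨fun x => ?_, fun x => ?_⟩
      · obtain ⟨y, hy, -⟩ := h (Nat.pair x 0)
        exact ⟨_, by simpa using hy⟩
      · obtain ⟨y, -, hy⟩ := h (Nat.pair 0 x)
        exact ⟨_, by simpa using hy⟩

/-- If `D` is a nonempty decidable set, every `Π⁰₂` set reduces to the set of the enumerations
of `D`, in such a way that the elements outside of the set are mapped to functions with a finite
range. -/
theorem IsPi02.exists_reduction {P : Set (ℕ → ℕ)} (hP : IsPi02 P) {D : Set ℕ}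
    (hD : PrimrecPred fun k => k ∈ D) (hne : D.Nonempty) :
    ∃ F : (ℕ → ℕ) → ℕ → ℕ, ComputableOperator F ∧ (∀ f ∈ P, Set.range (F f) = D) ∧
      ∀ f ∉ P, (Set.range (F f)).Finite := by
  classical
  obtain ⟨Q, ⟨χ, hχ, hχQ⟩, hQ⟩ := hP
  obtain ⟨d, hd⟩ := hne
  have hu1 : Primrec fun n : ℕ => n.unpair.1 := Primrec.fst.comp Primrec.unpair
  have hu2 : Primrec fun n : ℕ => n.unpair.2 := Primrec.snd.comp Primrec.unpair
  let C : List ℕ → ℕ → Prop := fun l n =>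
    n.unpair.1 ∈ D ∧ ∀ x < n.unpair.1 + 1, ∃ y < n.unpair.2 + 1, 1 = l.getD (Nat.pair x y) 0
  have hC : PrimrecPred fun p : List ℕ × ℕ => C p.1 p.2 := by
    refine (hD.comp (hu1.comp Primrec.snd)).and ?_
    refine PrimrecPred.ball_lt (Primrec.succ.comp (hu1.comp Primrec.snd))
      (R := fun (p : List ℕ × ℕ) x => ∃ y < p.2.unpair.2 + 1, 1 = p.1.getD (Nat.pair x y) 0) ?_
    refine PrimrecPred.bex_lt (Primrec.succ.comp (hu2.comp (Primrec.snd.comp Primrec.fst)))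
      (R := fun (p : (List ℕ × ℕ) × ℕ) y => 1 = p.1.1.getD (Nat.pair p.2 y) 0) ?_
    exact Primrec.eq.comp (Primrec.const 1) ((Primrec.list_getD 0).comp
      (Primrec.fst.comp (Primrec.fst.comp Primrec.fst))
      (Primrec₂.natPair.comp (Primrec.snd.comp Primrec.fst) Primrec.snd))
  let g : ℕ → ℕ := fun q =>
    if C (Denumerable.ofNat (List ℕ) q.unpair.1) q.unpair.2 then q.unpair.2.unpair.1 else d
  have hg : Primrec g := Primrec.ite (hC.comp (Primrec.pair ((Primrec.ofNat _).comp hu1) hu2))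
    (hu1.comp hu2) (Primrec.const d)
  -- A prefix long enough to contain the index `Nat.pair x y` for all `x ≤ n.unpair.1` and `y ≤
  -- n.unpair.2`.
  let L : ℕ → ℕ := fun n => Nat.pair (n.unpair.1 + n.unpair.2 + 1) (n.unpair.1 + n.unpair.2 + 1)
  have hsum : Primrec fun n : ℕ => n.unpair.1 + n.unpair.2 + 1 :=
    Primrec.succ.comp (Primrec.nat_add.comp hu1 hu2)
  have hL : Primrec L := Primrec₂.natPair.comp hsum hsum
  -- The input codes a candidate `k` and a search bound for the witnesses; the fixed element `d` of
  -- `D` is the filler while the search has not succeeded.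
  let F : (ℕ → ℕ) → ℕ → ℕ := fun f n =>
    if n.unpair.1 ∈ D ∧ ∀ x ≤ n.unpair.1, ∃ y ≤ n.unpair.2, Q f x y then n.unpair.1 else d
  have hF : ComputableOperator F := by
    convert primrec_comp hg ((hχ.map_range.comp_primrec hL).pair (of_primrec Primrec.id))
      using 3 with f n
    simp only [g, id, Nat.unpair_pair, Denumerable.ofNat_encode]
    refine if_congr (and_congr_right fun _ => ?_) rfl rfl
    refine forall_congr' fun x => ?_
    rw [Nat.lt_succ_iff]
    refine imp_congr_right fun hx => exists_congr fun y => ?_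
    rw [Nat.lt_succ_iff]
    refine and_congr_right fun hy => ?_
    have hlt : Nat.pair x y < L n :=
      (Nat.pair_lt_pair_left y (by omega)).trans (Nat.pair_lt_pair_right _ (by omega))
    have : ((List.range (L n)).map (χ f)).getD (Nat.pair x y) 0 = χ f (Nat.pair x y) := by
      simp [List.getD, hlt]
    rw [this]
    refine ⟨fun h => ((hχQ ..).1 h).symm, fun h => ?_⟩
    by_contra h'
    rw [(hχQ ..).2 h'] at h
    exact one_ne_zero h
  have hFD (f n) : F f n ∈ D := by
    simp only [F]
    split_ifs with h
    exacts [h.1, hd]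
  refine ⟨F, hF, fun f hf => ?_, fun f hf => ?_⟩
  · refine Set.Subset.antisymm (Set.range_subset_iff.2 (hFD f)) fun k hk => ?_
    choose y hy using (hQ f).1 hf
    refine ⟨Nat.pair k ((Finset.range (k + 1)).sup y), ?_⟩
    simp only [F, Nat.unpair_pair]
    exact if_pos ⟨hk, fun x hx => ⟨y x, Finset.le_sup (f := y) (by simp; omega), hy x⟩⟩
  · rw [hQ] at hf
    push Not at hf
    obtain ⟨x, hx⟩ := hf
    -- An `x` without witness blocks every `k ≥ x`, leaving only smaller values and the filler.
    refine ((Set.finite_Iio x).union (Set.finite_singleton d)).subset ?_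
    rintro _ ⟨n, rfl⟩
    simp only [F]
    split_ifs with h
    · left
      by_contra hlt
      obtain ⟨y, -, hy⟩ := h.2 x (not_lt.1 hlt)
      exact hx y hy
    · right; rfl

end Pi02

/-! ### Arithmetic of codes -/

namespace RatCode

/-- Addition of rational codes. -/
def add (k l : ℕ) : ℕ :=
  Nat.pair (Nat.pair
    (k.unpair.1.unpair.1 * (l.unpair.2 + 1) + l.unpair.1.unpair.1 * (k.unpair.2 + 1))
    (k.unpair.1.unpair.2 * (l.unpair.2 + 1) + l.unpair.1.unpair.2 * (k.unpair.2 + 1)))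
    -- Denominators are stored minus one, and this is `(c + 1) * (c' + 1) - 1`.
    (k.unpair.2 * l.unpair.2 + k.unpair.2 + l.unpair.2)

/-- Multiplication of rational codes. -/
def mul (k l : ℕ) : ℕ :=
  Nat.pair (Nat.pair
    (k.unpair.1.unpair.1 * l.unpair.1.unpair.1 + k.unpair.1.unpair.2 * l.unpair.1.unpair.2)
    (k.unpair.1.unpair.1 * l.unpair.1.unpair.2 + k.unpair.1.unpair.2 * l.unpair.1.unpair.1))
    (k.unpair.2 * l.unpair.2 + k.unpair.2 + l.unpair.2)

/-- Negation of rational codes. -/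
def neg (k : ℕ) : ℕ :=
  Nat.pair (Nat.pair k.unpair.1.unpair.2 k.unpair.1.unpair.1) k.unpair.2

/-- The rational code of a positive rational code. -/
def ofPos (k : ℕ) : ℕ := Nat.pair (Nat.pair (k.unpair.1 + 1) 0) k.unpair.2

/-- The rational code of the number one. -/
def one : ℕ := Nat.pair (Nat.pair 1 0) 0

theorem ratOfCode_add (k l : ℕ) : ratOfCode (add k l) = ratOfCode k + ratOfCode l := by
  simp only [ratOfCode, add, Nat.unpair_pair]
  have hk : ((k.unpair.2 : ℚ) + 1) ≠ 0 := by positivity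
  have hl : ((l.unpair.2 : ℚ) + 1) ≠ 0 := by positivity
  rw [div_add_div _ _ hk hl]
  push_cast
  congr 1 <;> ring

theorem ratOfCode_mul (k l : ℕ) : ratOfCode (mul k l) = ratOfCode k * ratOfCode l := by
  simp only [ratOfCode, mul, Nat.unpair_pair]
  rw [div_mul_div_comm]
  push_cast
  congr 1 <;> ring

theorem ratOfCode_neg (k : ℕ) : ratOfCode (neg k) = -ratOfCode k := by
  simp only [ratOfCode, neg, Nat.unpair_pair]
  ring

theorem ratOfCode_ofPos (k : ℕ) : ratOfCode (ofPos k) = posRatOfCode k := by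
  simp [ratOfCode, posRatOfCode, ofPos]

theorem ratOfCode_one : ratOfCode one = 1 := by
  simp [ratOfCode, one]

theorem ratOfCode_zero : ratOfCode 0 = 0 := by
  simp [ratOfCode]

theorem ratOfCode_surjective : Function.Surjective ratOfCode := by
  intro q
  refine ⟨Nat.pair (Nat.pair q.num.toNat (-q.num).toNat) (q.den - 1), ?_⟩
  simp only [ratOfCode, Nat.unpair_pair]
  have h1 : ((q.den - 1 : ℕ) : ℚ) + 1 = q.den := by
    have := q.den_pos
    exact_mod_cast Nat.sub_add_cancel this
  have h2 : ((q.num.toNat : ℚ) - ((-q.num).toNat : ℚ)) = q.num := by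
    exact_mod_cast Int.toNat_sub_toNat_neg q.num
  rw [h1, h2, Rat.num_div_den]

theorem posRatOfCode_pos (k : ℕ) : 0 < posRatOfCode k := by
  unfold posRatOfCode; positivity

theorem exists_posRatOfCode_eq {q : ℚ} (hq : 0 < q) : ∃ k, posRatOfCode k = q := by
  refine ⟨Nat.pair (q.num.toNat - 1) (q.den - 1), ?_⟩
  simp only [posRatOfCode, Nat.unpair_pair]
  have hn := Rat.num_pos.2 hq
  have h1 : ((q.den - 1 : ℕ) : ℚ) + 1 = q.den := by
    exact_mod_cast Nat.sub_add_cancel q.den_pos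
  have h2 : ((q.num.toNat - 1 : ℕ) : ℚ) + 1 = q.num := by
    have h3 : q.num.toNat - 1 + 1 = q.num.toNat := by omega
    have h4 : (q.num.toNat : ℤ) = q.num := Int.toNat_of_nonneg hn.le
    exact_mod_cast (congrArg (Nat.cast (R := ℤ)) h3).trans h4
  rw [h1, h2, Rat.num_div_den]

theorem primrec_unpair_fst : Primrec fun n : ℕ => n.unpair.1 := Primrec.fst.comp Primrec.unpair

theorem primrec_unpair_snd : Primrec fun n : ℕ => n.unpair.2 := Primrec.snd.comp Primrec.unpair

theorem primrec₂_add : Primrec₂ add := by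
  have h11 := primrec_unpair_fst.comp primrec_unpair_fst
  have h21 := primrec_unpair_snd.comp primrec_unpair_fst
  have a1 := h11.comp (Primrec.fst (α := ℕ) (β := ℕ))
  have b1 := h21.comp (Primrec.fst (α := ℕ) (β := ℕ))
  have c1 := primrec_unpair_snd.comp (Primrec.fst (α := ℕ) (β := ℕ))
  have a2 := h11.comp (Primrec.snd (α := ℕ) (β := ℕ))
  have b2 := h21.comp (Primrec.snd (α := ℕ) (β := ℕ))
  have c2 := primrec_unpair_snd.comp (Primrec.snd (α := ℕ) (β := ℕ))
  have d1 := Primrec.succ.comp c1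
  have d2 := Primrec.succ.comp c2
  have x := Primrec.nat_add.comp (Primrec.nat_mul.comp a1 d2) (Primrec.nat_mul.comp a2 d1)
  have y := Primrec.nat_add.comp (Primrec.nat_mul.comp b1 d2) (Primrec.nat_mul.comp b2 d1)
  have z := Primrec.nat_add.comp (Primrec.nat_add.comp (Primrec.nat_mul.comp c1 c2) c1) c2
  have h := Primrec₂.natPair.comp (Primrec₂.natPair.comp x y) z
  exact h

theorem primrec₂_mul : Primrec₂ mul := by
  have h11 := primrec_unpair_fst.comp primrec_unpair_fst
  have h21 := primrec_unpair_snd.comp primrec_unpair_fst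
  have a1 := h11.comp (Primrec.fst (α := ℕ) (β := ℕ))
  have b1 := h21.comp (Primrec.fst (α := ℕ) (β := ℕ))
  have c1 := primrec_unpair_snd.comp (Primrec.fst (α := ℕ) (β := ℕ))
  have a2 := h11.comp (Primrec.snd (α := ℕ) (β := ℕ))
  have b2 := h21.comp (Primrec.snd (α := ℕ) (β := ℕ))
  have c2 := primrec_unpair_snd.comp (Primrec.snd (α := ℕ) (β := ℕ))
  have x := Primrec.nat_add.comp (Primrec.nat_mul.comp a1 a2) (Primrec.nat_mul.comp b1 b2)
  have y := Primrec.nat_add.comp (Primrec.nat_mul.comp a1 b2) (Primrec.nat_mul.comp b1 a2)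
  have z := Primrec.nat_add.comp (Primrec.nat_add.comp (Primrec.nat_mul.comp c1 c2) c1) c2
  have h := Primrec₂.natPair.comp (Primrec₂.natPair.comp x y) z
  exact h

theorem primrec_neg : Primrec neg :=
  Primrec₂.natPair.comp (Primrec₂.natPair.comp (primrec_unpair_snd.comp primrec_unpair_fst)
    (primrec_unpair_fst.comp primrec_unpair_fst)) primrec_unpair_snd

theorem primrec_ofPos : Primrec ofPos :=
  Primrec₂.natPair.comp (Primrec₂.natPair.comp (Primrec.succ.comp primrec_unpair_fst)
    (Primrec.const 0)) primrec_unpair_snd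

/-- Clearing denominators and moving the subtracted parts across leaves an inequality between
natural numbers. -/
theorem primrecRel_lt : PrimrecRel fun k l => ratOfCode k < ratOfCode l := by
  have h : PrimrecRel fun k l : ℕ =>
      k.unpair.1.unpair.1 * (l.unpair.2 + 1) + l.unpair.1.unpair.2 * (k.unpair.2 + 1) <
        l.unpair.1.unpair.1 * (k.unpair.2 + 1) + k.unpair.1.unpair.2 * (l.unpair.2 + 1) := by
    have h11 := primrec_unpair_fst.comp primrec_unpair_fst
    have h21 := primrec_unpair_snd.comp primrec_unpair_fst
    have a1 := h11.comp (Primrec.fst (α := ℕ) (β := ℕ))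
    have b1 := h21.comp (Primrec.fst (α := ℕ) (β := ℕ))
    have d1 := Primrec.succ.comp
      (primrec_unpair_snd.comp (Primrec.fst (α := ℕ) (β := ℕ)))
    have a2 := h11.comp (Primrec.snd (α := ℕ) (β := ℕ))
    have b2 := h21.comp (Primrec.snd (α := ℕ) (β := ℕ))
    have d2 := Primrec.succ.comp
      (primrec_unpair_snd.comp (Primrec.snd (α := ℕ) (β := ℕ)))
    have x := Primrec.nat_add.comp (Primrec.nat_mul.comp a1 d2) (Primrec.nat_mul.comp b2 d1)
    have y := Primrec.nat_add.comp (Primrec.nat_mul.comp a2 d1) (Primrec.nat_mul.comp b1 d2)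
    have h := Primrec.nat_lt.comp x y
    exact h
  refine h.of_eq fun k l => ?_
  have hk : 0 < ((k.unpair.2 : ℚ) + 1) := by positivity
  have hl : 0 < ((l.unpair.2 : ℚ) + 1) := by positivity
  rw [ratOfCode, ratOfCode, div_lt_div_iff₀ hk hl, ← Nat.cast_lt (α := ℚ)]
  push_cast
  constructor <;> intro h <;> linarith

theorem primrecPred_lt {α : Type*} [Primcodable α] {k l : α → ℕ} (hk : Primrec k)
    (hl : Primrec l) : PrimrecPred fun a => ratOfCode (k a) < ratOfCode (l a) :=
  (primrecRel_lt.comp hk hl :)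

end RatCode

open RatCode

/-- The diagram code `k'` refines the diagram code `k`: same vector, and the closure of the interval
of `k'` is contained in the interval of `k`. -/
def Refines (k' k : ℕ) : Prop :=
  k'.unpair.1 = k.unpair.1 ∧
    |ratOfCode k'.unpair.2.unpair.1 - ratOfCode k.unpair.2.unpair.1| +
      posRatOfCode k'.unpair.2.unpair.2 < posRatOfCode k.unpair.2.unpair.2

theorem primrecRel_refines : PrimrecRel Refines := by
  have hc : Primrec fun k : ℕ => k.unpair.2.unpair.1 :=
    primrec_unpair_fst.comp primrec_unpair_snd
  have hr : Primrec fun k : ℕ => ofPos k.unpair.2.unpair.2 :=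
    primrec_ofPos.comp (primrec_unpair_snd.comp primrec_unpair_snd)
  have h : PrimrecRel fun k' k : ℕ => k'.unpair.1 = k.unpair.1 ∧
      ratOfCode (add k'.unpair.2.unpair.1 (ofPos k'.unpair.2.unpair.2)) <
        ratOfCode (add k.unpair.2.unpair.1 (ofPos k.unpair.2.unpair.2)) ∧
      ratOfCode (add k.unpair.2.unpair.1 (ofPos k'.unpair.2.unpair.2)) <
        ratOfCode (add k'.unpair.2.unpair.1 (ofPos k.unpair.2.unpair.2)) :=
    (Primrec.eq.comp (primrec_unpair_fst.comp Primrec.fst)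
      (primrec_unpair_fst.comp Primrec.snd)).and
    ((primrecPred_lt (primrec₂_add.comp (hc.comp Primrec.fst) (hr.comp Primrec.fst))
      (primrec₂_add.comp (hc.comp Primrec.snd) (hr.comp Primrec.snd))).and
    (primrecPred_lt (primrec₂_add.comp (hc.comp Primrec.snd) (hr.comp Primrec.fst))
      (primrec₂_add.comp (hc.comp Primrec.fst) (hr.comp Primrec.snd))))
  refine h.of_eq fun k' k => and_congr_right fun _ => ?_
  simp only [ratOfCode_add, ratOfCode_ofPos]
  rw [← lt_sub_iff_add_lt (a := |_|), abs_lt]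
  constructor
  · rintro ⟨h1, h2⟩; constructor <;> linarith
  · rintro ⟨h1, h2⟩; constructor <;> linarith

/-! ### Coded finite sums and coded scalars -/

/-- The iterated sum `g 0 + ⋯ + g (m - 1)` of codes, for a given addition of codes. -/
def sumCodes (add : ℕ → ℕ → ℕ) (m : ℕ) (g : ℕ → ℕ) : ℕ := ((List.range m).map g).foldr add 0

theorem primrec_sumCodes {α : Type*} [Primcodable α] {add : ℕ → ℕ → ℕ} (hadd : Primrec₂ add)
    {m : α → ℕ} (hm : Primrec m) {g : α → ℕ → ℕ} (hg : Primrec₂ g) :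
    Primrec fun a => sumCodes add (m a) (g a) :=
  Primrec.list_foldr (Primrec.list_map (Primrec.list_range.comp hm) hg) (Primrec.const 0)
    (hadd.comp (Primrec.fst.comp Primrec.snd) (Primrec.snd.comp Primrec.snd)).to₂

theorem map_sumCodes {M : Type*} [AddCommMonoid M] {add : ℕ → ℕ → ℕ} {σ : ℕ → M}
    (h0 : σ 0 = 0) (hadd : ∀ k l, σ (add k l) = σ k + σ l) (m : ℕ) (g : ℕ → ℕ) :
    σ (sumCodes add m g) = ∑ j ∈ Finset.range m, σ (g j) := by
  have key (l : List ℕ) : σ (l.foldr add 0) = (l.map σ).sum := by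
    induction l with
    | nil => simpa using h0
    | cons a l ih => simp [hadd, ih]
  rw [sumCodes, key]
  induction m with
  | zero => simp
  | succ m ih => simp [List.range_succ, Finset.sum_range_succ, ← ih]

/-- A coding of a dense subring of scalars with primitive recursive operations. -/
structure ScalarCoding {𝕜 : Type*} [RCLike 𝕜] (σ : ℕ → 𝕜) where
  add : ℕ → ℕ → ℕ
  mul : ℕ → ℕ → ℕ
  normSq : ℕ → ℕ
  one : ℕ
  primrec_add : Primrec₂ add
  primrec_mul : Primrec₂ mul
  primrec_normSq : Primrec normSq
  map_zero : σ 0 = 0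
  map_one : σ one = 1
  map_add : ∀ k l, σ (add k l) = σ k + σ l
  map_mul : ∀ k l, σ (mul k l) = σ k * σ l
  map_normSq : ∀ k, ((ratOfCode (normSq k) : ℚ) : ℝ) = ‖σ k‖ ^ 2
  dense : DenseRange σ

/-- The coding of the rational numbers in the reals. -/
def realScalarCoding : ScalarCoding realScalar where
  add := add
  mul := mul
  normSq k := mul k k
  one := one
  primrec_add := primrec₂_add
  primrec_mul := primrec₂_mul
  primrec_normSq := primrec₂_mul.comp Primrec.id Primrec.id
  map_zero := by simp [realScalar, ratOfCode_zero]
  map_one := by simp [realScalar, ratOfCode_one]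
  map_add k l := by simp [realScalar, ratOfCode_add]
  map_mul k l := by simp [realScalar, ratOfCode_mul]
  map_normSq k := by simp [realScalar, ratOfCode_mul, Real.norm_eq_abs, sq, -Rat.norm_cast_real]
  dense := Rat.denseRange_cast.comp ratOfCode_surjective.denseRange Rat.continuous_coe_real

/-- The coding of the Gaussian rationals in the complex numbers. -/
def complexScalarCoding : ScalarCoding complexScalar where
  add k l := Nat.pair (add k.unpair.1 l.unpair.1) (add k.unpair.2 l.unpair.2)
  mul k l := Nat.pair
    (add (mul k.unpair.1 l.unpair.1) (neg (mul k.unpair.2 l.unpair.2)))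
    (add (mul k.unpair.1 l.unpair.2) (mul k.unpair.2 l.unpair.1))
  normSq k := add (mul k.unpair.1 k.unpair.1) (mul k.unpair.2 k.unpair.2)
  one := Nat.pair one 0
  primrec_add := by
    have a1 := primrec_unpair_fst.comp (Primrec.fst (α := ℕ) (β := ℕ))
    have b1 := primrec_unpair_snd.comp (Primrec.fst (α := ℕ) (β := ℕ))
    have a2 := primrec_unpair_fst.comp (Primrec.snd (α := ℕ) (β := ℕ))
    have b2 := primrec_unpair_snd.comp (Primrec.snd (α := ℕ) (β := ℕ))
    have h := Primrec₂.natPair.comp (primrec₂_add.comp a1 a2) (primrec₂_add.comp b1 b2)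
    exact h
  primrec_mul := by
    have a1 := primrec_unpair_fst.comp (Primrec.fst (α := ℕ) (β := ℕ))
    have b1 := primrec_unpair_snd.comp (Primrec.fst (α := ℕ) (β := ℕ))
    have a2 := primrec_unpair_fst.comp (Primrec.snd (α := ℕ) (β := ℕ))
    have b2 := primrec_unpair_snd.comp (Primrec.snd (α := ℕ) (β := ℕ))
    have x := primrec₂_add.comp (primrec₂_mul.comp a1 a2)
      (primrec_neg.comp (primrec₂_mul.comp b1 b2))
    have y := primrec₂_add.comp (primrec₂_mul.comp a1 b2) (primrec₂_mul.comp b1 a2)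
    have h := Primrec₂.natPair.comp x y
    exact h
  primrec_normSq := primrec₂_add.comp
    (primrec₂_mul.comp primrec_unpair_fst primrec_unpair_fst)
    (primrec₂_mul.comp primrec_unpair_snd primrec_unpair_snd)
  map_zero := by simp [complexScalar, ratOfCode_zero]
  map_one := by simp [complexScalar, ratOfCode_zero, ratOfCode_one]
  map_add k l := by
    simp only [complexScalar, Nat.unpair_pair, ratOfCode_add]; push_cast; ring
  map_mul k l := by
    simp only [complexScalar, Nat.unpair_pair, ratOfCode_add, ratOfCode_mul, ratOfCode_neg]
    push_cast
    linear_combination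
      (-(ratOfCode k.unpair.2 : ℂ) * (ratOfCode l.unpair.2 : ℂ)) * Complex.I_sq
  map_normSq k := by
    rw [← Complex.normSq_eq_norm_sq]
    simp [complexScalar, Complex.normSq_apply, ratOfCode_add, ratOfCode_mul]
  dense := by
    have hd : DenseRange fun k : ℕ => (realScalar k.unpair.1, realScalar k.unpair.2) :=
      (realScalarCoding.dense.prodMap realScalarCoding.dense).comp
        (f := fun k : ℕ => k.unpair) Nat.pairEquiv.symm.surjective.denseRange
        continuous_of_discreteTopology
    have := Complex.equivRealProdCLM.symm.surjective.denseRange.comp hd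
      Complex.equivRealProdCLM.symm.continuous
    refine this.mono ?_
    rintro _ ⟨k, rfl⟩
    refine ⟨k, ?_⟩
    simp [complexScalar, realScalar, Complex.equivRealProdCLM_symm_apply]

/-! ### Linear combinations with coded coefficients -/

section LinComb

variable {𝕜 B : Type*} [RCLike 𝕜] [NormedAddCommGroup B] [NormedSpace 𝕜 B] {σ : ℕ → 𝕜}

/-- The linear combination of the vectors `x j` with the coefficients coded by the list `l`. -/
noncomputable def linComb (σ : ℕ → 𝕜) (x : ℕ → B) (l : List ℕ) : B :=
  ∑ j ∈ Finset.range l.length, σ (l.getD j 0) • x j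

/-- The diagram of a sequence of vectors. -/
def seqDiagram (σ : ℕ → 𝕜) (x : ℕ → B) : Set ℕ :=
  {k | ‖linComb σ x (Denumerable.ofNat (List ℕ) k.unpair.1)‖ ∈ ratInterval k.unpair.2}

theorem mem_ratInterval {n : ℕ} {r : ℝ} :
    r ∈ ratInterval n ↔ |r - (ratOfCode n.unpair.1 : ℝ)| < (posRatOfCode n.unpair.2 : ℝ) := by
  rw [ratInterval, Metric.mem_ball, Real.dist_eq]

namespace ScalarCoding

theorem linComb_eq_sum_range (C : ScalarCoding σ) (x : ℕ → B) (l : List ℕ) {M : ℕ} (hM : l.length ≤ M) :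
    linComb σ x l = ∑ j ∈ Finset.range M, σ (l.getD j 0) • x j := by
  refine Finset.sum_subset (Finset.range_mono hM) fun j _ hj => ?_
  rw [List.getD_eq_default _ _ (by simpa using hj), C.map_zero, zero_smul]

variable (C : ScalarCoding σ)

/-- The coefficients of the linear combination with coefficients `l` of the linear combinations with
coefficients given by the members of `W`. -/
def comb (W : List (List ℕ)) (l : List ℕ) : List ℕ :=
  -- The total length is a crude bound for the length of every row; shorter rows are padded with
  -- `0`, which codes the zero scalar.
  (List.range W.flatten.length).map fun i =>
    sumCodes C.add l.length fun j => C.mul (l.getD j 0) ((W.getD j []).getD i 0)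

theorem length_getD_le_length_flatten (W : List (List ℕ)) (j : ℕ) :
    (W.getD j []).length ≤ W.flatten.length := by
  rcases lt_or_ge j W.length with h | h
  · rw [List.getD_eq_getElem _ _ h]
    exact (List.sublist_flatten_of_mem (List.getElem_mem h)).length_le
  · rw [List.getD_eq_default _ _ h]; simp

theorem linComb_comb (x : ℕ → B) (W : List (List ℕ)) (l : List ℕ) :
    linComb σ x (C.comb W l) = linComb σ (fun j => linComb σ x (W.getD j [])) l := by
  have h1 : linComb σ x (C.comb W l) = ∑ i ∈ Finset.range W.flatten.length,
      ∑ j ∈ Finset.range l.length, (σ (l.getD j 0) * σ ((W.getD j []).getD i 0)) • x i := by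
    rw [linComb]
    refine Finset.sum_congr (by simp [comb]) fun i hi => ?_
    have hi' : i < W.flatten.length := by simpa [comb] using hi
    have : (C.comb W l).getD i 0 =
        sumCodes C.add l.length fun j => C.mul (l.getD j 0) ((W.getD j []).getD i 0) := by
      rw [comb, List.getD_eq_getElem _ _ (by simpa using hi')]
      simp
    rw [this, map_sumCodes C.map_zero C.map_add, Finset.sum_smul]
    simp only [C.map_mul]
  rw [h1, Finset.sum_comm, linComb]
  refine Finset.sum_congr rfl fun j _ => ?_
  rw [C.linComb_eq_sum_range x _ (length_getD_le_length_flatten W j), Finset.smul_sum]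
  simp only [mul_smul]

/-- The action of `comb` on diagram codes. -/
def combCode (W : List (List ℕ)) (k : ℕ) : ℕ :=
  Nat.pair (Encodable.encode (C.comb W (Denumerable.ofNat (List ℕ) k.unpair.1))) k.unpair.2

/-- Substituting rational combinations into a diagram code turns a question about a new sequence
into one about the diagram of `x`. The realization conditions thereby need only one fixed diagram.
-/
theorem combCode_mem_seqDiagram (x : ℕ → B) (W : List (List ℕ)) (k : ℕ) :
    C.combCode W k ∈ seqDiagram σ x ↔
      k ∈ seqDiagram σ fun j => linComb σ x (W.getD j []) := by
  simp only [seqDiagram, combCode, Set.mem_ofPred_eq, Nat.unpair_pair, Denumerable.ofNat_encode,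
    linComb_comb]

theorem primrec₂_comb : Primrec₂ C.comb := by
  refine Primrec.list_map (f := fun p : List (List ℕ) × List ℕ => List.range p.1.flatten.length)
    (g := fun p i => sumCodes C.add p.2.length
      fun j => C.mul (p.2.getD j 0) ((p.1.getD j []).getD i 0))
    (Primrec.list_range.comp (Primrec.list_length.comp (Primrec.list_flatten.comp Primrec.fst))) ?_
  refine primrec_sumCodes (m := fun q : (List (List ℕ) × List ℕ) × ℕ => q.1.2.length)
    (g := fun q j => C.mul (q.1.2.getD j 0) ((q.1.1.getD j []).getD q.2 0))
    C.primrec_add (Primrec.list_length.comp (Primrec.snd.comp Primrec.fst)) ?_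
  exact C.primrec_mul.comp
    ((Primrec.list_getD 0).comp (Primrec.snd.comp (Primrec.fst.comp Primrec.fst)) Primrec.snd)
    ((Primrec.list_getD 0).comp
      ((Primrec.list_getD []).comp (Primrec.fst.comp (Primrec.fst.comp Primrec.fst)) Primrec.snd)
      (Primrec.snd.comp Primrec.fst))

theorem primrec₂_combCode : Primrec₂ C.combCode :=
  Primrec₂.natPair.comp
    (Primrec.encode.comp (C.primrec₂_comb.comp Primrec.fst
      ((Primrec.ofNat _).comp (primrec_unpair_fst.comp Primrec.snd))))
    (primrec_unpair_snd.comp Primrec.snd)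

/-- The diagram of a sequence whose nonzero members are orthonormal, at computable places, is
decidable. -/
theorem primrecPred_seqDiagram (C : ScalarCoding σ) {e : ℕ → B} {cut : ℕ → ℕ} (hcut : Primrec cut)
    (he : ∀ (M : ℕ) (a : ℕ → 𝕜),
      ‖∑ j ∈ Finset.range M, a j • e j‖ ^ 2 = ∑ j ∈ Finset.range (cut M), ‖a j‖ ^ 2) :
    PrimrecPred fun k => k ∈ seqDiagram σ e := by
  let s : ℕ → ℕ := fun k => sumCodes RatCode.add
    (cut (Denumerable.ofNat (List ℕ) k.unpair.1).length)
    fun j => C.normSq ((Denumerable.ofNat (List ℕ) k.unpair.1).getD j 0)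
  have hl : Primrec fun k : ℕ => Denumerable.ofNat (List ℕ) k.unpair.1 :=
    (Primrec.ofNat _).comp primrec_unpair_fst
  have hs : Primrec s := primrec_sumCodes primrec₂_add (hcut.comp (Primrec.list_length.comp hl))
    (C.primrec_normSq.comp ((Primrec.list_getD 0).comp (hl.comp Primrec.fst) Primrec.snd))
  have hs' (k : ℕ) : (ratOfCode (s k) : ℝ) =
      ‖linComb σ e (Denumerable.ofNat (List ℕ) k.unpair.1)‖ ^ 2 := by
    rw [linComb, he, map_sumCodes (σ := fun k => (ratOfCode k : ℝ))
      (by simp [ratOfCode_zero]) (by simp [ratOfCode_add])]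
    simp only [C.map_normSq]
  let c : ℕ → ℕ := fun k => k.unpair.2.unpair.1
  let r : ℕ → ℕ := fun k => ofPos k.unpair.2.unpair.2
  have hc : Primrec c := primrec_unpair_fst.comp primrec_unpair_snd
  have hr : Primrec r := primrec_ofPos.comp (primrec_unpair_snd.comp primrec_unpair_snd)
  let lo : ℕ → ℕ := fun k => RatCode.add (c k) (neg (r k))
  let hi : ℕ → ℕ := fun k => RatCode.add (c k) (r k)
  have hlo : Primrec lo := primrec₂_add.comp hc (primrec_neg.comp hr)
  have hhi : Primrec hi := primrec₂_add.comp hc hr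
  -- Only the square of the norm is rational, so both endpoints are compared after squaring; the
  -- sign tests cover negative endpoints.
  have main : PrimrecPred fun k =>
      (ratOfCode (lo k) < ratOfCode 0 ∨
        ratOfCode (RatCode.mul (lo k) (lo k)) < ratOfCode (s k)) ∧
      ratOfCode 0 < ratOfCode (hi k) ∧
        ratOfCode (s k) < ratOfCode (RatCode.mul (hi k) (hi k)) :=
    ((primrecPred_lt hlo (Primrec.const 0)).or
      (primrecPred_lt (primrec₂_mul.comp hlo hlo) hs)).and
    ((primrecPred_lt (Primrec.const 0) hhi).and
      (primrecPred_lt hs (primrec₂_mul.comp hhi hhi)))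
  refine main.of_eq fun k => ?_
  set N := ‖linComb σ e (Denumerable.ofNat (List ℕ) k.unpair.1)‖ with hN
  have hN0 : 0 ≤ N := norm_nonneg _
  have h1 : (ratOfCode (lo k) : ℝ) = ratOfCode (c k) - ratOfCode (r k) := by
    simp only [lo, ratOfCode_add, ratOfCode_neg]; push_cast; ring
  have h2 : (ratOfCode (hi k) : ℝ) = ratOfCode (c k) + ratOfCode (r k) := by
    simp only [hi, ratOfCode_add]; push_cast; ring
  have h3 : (ratOfCode (r k) : ℝ) = posRatOfCode k.unpair.2.unpair.2 := by
    simp only [r, ratOfCode_ofPos]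
  have h4 : k ∈ seqDiagram σ e ↔ (ratOfCode (lo k) : ℝ) < N ∧ N < ratOfCode (hi k) := by
    change N ∈ ratInterval k.unpair.2 ↔ _
    rw [mem_ratInterval, abs_lt, h1, h2, ← h3]
    constructor <;> rintro ⟨h, h'⟩ <;> constructor <;> linarith
  rw [h4, ← Rat.cast_lt (K := ℝ), ← Rat.cast_lt (K := ℝ), ← Rat.cast_lt (K := ℝ),
    ← Rat.cast_lt (K := ℝ), hs', ratOfCode_mul, ratOfCode_mul, ratOfCode_zero, ← hN]
  push_cast
  refine and_congr ?_ ?_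
  · constructor
    · rintro (h | h)
      · linarith
      · exact lt_of_pow_lt_pow_left₀ 2 hN0 (by rwa [sq (ratOfCode (lo k) : ℝ)])
    · intro h
      rcases lt_or_ge (ratOfCode (lo k) : ℝ) 0 with h0 | h0
      · exact Or.inl h0
      · right; nlinarith
  · constructor
    · rintro ⟨h0, h⟩
      exact lt_of_pow_lt_pow_left₀ 2 h0.le (by rwa [sq (ratOfCode (hi k) : ℝ)])
    · intro h
      exact ⟨by linarith, by nlinarith⟩

end ScalarCoding

end LinComb

/-! ### The conditions on the range of a name -/

section Cut

variable {𝕜 : Type*} [RCLike 𝕜] {σ : ℕ → 𝕜}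

/-- A set of diagram codes that locates the norm of each rational vector to any precision, and is
closed under the obvious operations. -/
structure IsCut (D : Set ℕ) : Prop where
  precise : ∀ m p : ℕ, ∃ k ∈ D, k.unpair.1 = m ∧
    posRatOfCode k.unpair.2.unpair.2 < posRatOfCode p
  rounded : ∀ k ∈ D, ∃ k' ∈ D, Refines k' k
  upper : ∀ k ∈ D, ∀ k', Refines k k' → k' ∈ D

/-- The strict inequality in `Refines` leaves room for the closed ball, so non-strict bounds that
survive a limit become strict again after one refinement. -/
theorem Refines.closedBall_subset {k' k : ℕ} (h : Refines k' k) :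
    Metric.closedBall (ratOfCode k'.unpair.2.unpair.1 : ℝ) (posRatOfCode k'.unpair.2.unpair.2) ⊆
      ratInterval k.unpair.2 := by
  refine Metric.closedBall_subset_ball' ?_
  have := h.2
  rw [Real.dist_eq, add_comm]
  exact_mod_cast this

theorem exists_posRatOfCode_lt {ε : ℝ} (hε : 0 < ε) : ∃ p, (posRatOfCode p : ℝ) < ε := by
  obtain ⟨q, hq0, hq⟩ := exists_rat_btwn hε
  obtain ⟨p, rfl⟩ := exists_posRatOfCode_eq (q := q) (by exact_mod_cast hq0)
  exact ⟨p, hq⟩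

theorem posRatOfCode_pos' (p : ℕ) : (0 : ℝ) < posRatOfCode p := by
  exact_mod_cast posRatOfCode_pos p

/-- A real number lies in rational intervals of any precision. -/
theorem exists_mem_ratInterval (r : ℝ) {ε : ℝ} (hε : 0 < ε) :
    ∃ n, r ∈ ratInterval n ∧ (posRatOfCode n.unpair.2 : ℝ) < ε := by
  obtain ⟨p, hp⟩ := exists_posRatOfCode_lt hε
  obtain ⟨q, h1, h2⟩ := exists_rat_btwn (sub_lt_self r (posRatOfCode_pos' p))
  obtain ⟨c, rfl⟩ := ratOfCode_surjective q
  refine ⟨Nat.pair c p, ?_, by simpa using hp⟩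
  rw [mem_ratInterval, abs_lt]
  simp only [Nat.unpair_pair]
  constructor <;> linarith [posRatOfCode_pos' p]

/-- The triangle inequality through `r` costs one radius of `k'`, and `Refines` adds another; hence
the factor two. -/
theorem refines_of_mem {k' k : ℕ} {r : ℝ} (hkk : k'.unpair.1 = k.unpair.1)
    (h' : |r - ratOfCode k'.unpair.2.unpair.1| ≤ (posRatOfCode k'.unpair.2.unpair.2 : ℝ))
    (hr : 2 * (posRatOfCode k'.unpair.2.unpair.2 : ℝ) +
      |r - ratOfCode k.unpair.2.unpair.1| < (posRatOfCode k.unpair.2.unpair.2 : ℝ)) :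
    Refines k' k := by
  refine ⟨hkk, ?_⟩
  have h := abs_sub_le (ratOfCode k'.unpair.2.unpair.1 : ℝ) r (ratOfCode k.unpair.2.unpair.1)
  rw [abs_sub_comm _ r] at h
  have : |(ratOfCode k'.unpair.2.unpair.1 : ℝ) - ratOfCode k.unpair.2.unpair.1| +
      posRatOfCode k'.unpair.2.unpair.2 < (posRatOfCode k.unpair.2.unpair.2 : ℝ) := by linarith
  exact_mod_cast this

variable {B : Type*} [NormedAddCommGroup B] [NormedSpace 𝕜 B]

theorem isCut_seqDiagram (x : ℕ → B) : IsCut (seqDiagram σ x) where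
  precise m p := by
    obtain ⟨n, hn, hp⟩ := exists_mem_ratInterval
      ‖linComb σ x (Denumerable.ofNat (List ℕ) m)‖ (posRatOfCode_pos' p)
    exact ⟨Nat.pair m n, by simpa [seqDiagram] using hn, by simp,
      by simpa using (by exact_mod_cast hp : posRatOfCode n.unpair.2 < posRatOfCode p)⟩
  rounded k hk := by
    have hk' := mem_ratInterval.1 hk
    -- Half of the distance from the norm to the boundary of the interval absorbs the factor two in
    -- `refines_of_mem`.
    obtain ⟨n, hn, hp⟩ := exists_mem_ratInterval
      ‖linComb σ x (Denumerable.ofNat (List ℕ) k.unpair.1)‖ (half_pos (sub_pos.2 hk'))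
    refine ⟨Nat.pair k.unpair.1 n, by simpa [seqDiagram] using hn, ?_⟩
    refine refines_of_mem (r := ‖linComb σ x (Denumerable.ofNat (List ℕ) k.unpair.1)‖)
      (by simp) (by simpa using (mem_ratInterval.1 hn).le) ?_
    simp only [Nat.unpair_pair]
    linarith
  upper k hk k' h := by
    have := h.closedBall_subset (Metric.ball_subset_closedBall hk)
    rwa [h.1] at this

/-- A cut is the diagram of any sequence that is compatible with it. -/
theorem IsCut.eq_seqDiagram {D : Set ℕ} (hD : IsCut D) {x : ℕ → B}
    (hx : ∀ k ∈ D, |‖linComb σ x (Denumerable.ofNat (List ℕ) k.unpair.1)‖ -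
      ratOfCode k.unpair.2.unpair.1| ≤ (posRatOfCode k.unpair.2.unpair.2 : ℝ)) :
    D = seqDiagram σ x := by
  ext k
  constructor
  · intro hk
    obtain ⟨k', hk', h⟩ := hD.rounded k hk
    have := h.closedBall_subset (by simpa [Real.dist_eq] using hx k' hk')
    rwa [h.1] at this
  · intro hk
    have hk' := mem_ratInterval.1 hk
    -- A sufficiently precise element of `D` for the same vector refines `k`, and upward closure
    -- puts `k` into `D`.
    obtain ⟨p, hp⟩ := exists_posRatOfCode_lt (half_pos (sub_pos.2 hk'))
    obtain ⟨k', hk'D, hkk, hk'p⟩ := hD.precise k.unpair.1 p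
    refine hD.upper k' hk'D k (refines_of_mem hkk (hx k' hk'D) ?_)
    rw [hkk]
    have : (posRatOfCode k'.unpair.2.unpair.2 : ℝ) < posRatOfCode p := by exact_mod_cast hk'p
    linarith

/-- A sequence compatible with the diagram of another one has the same norms. -/
theorem norm_linComb_eq {B' : Type*} [NormedAddCommGroup B'] [NormedSpace 𝕜 B'] {e : ℕ → B'}
    {x : ℕ → B}
    (hx : ∀ k ∈ seqDiagram σ e, |‖linComb σ x (Denumerable.ofNat (List ℕ) k.unpair.1)‖ -
      ratOfCode k.unpair.2.unpair.1| ≤ (posRatOfCode k.unpair.2.unpair.2 : ℝ)) (l : List ℕ) :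
    ‖linComb σ x l‖ = ‖linComb σ e l‖ := by
  refine eq_of_forall_dist_le fun ε hε => ?_
  rw [Real.dist_eq]
  obtain ⟨n, hn, hp⟩ := exists_mem_ratInterval ‖linComb σ e l‖ (half_pos hε)
  have h := hx (Nat.pair (Encodable.encode l) n) (by simpa [seqDiagram] using hn)
  simp only [Nat.unpair_pair, Denumerable.ofNat_encode] at h
  have h2 := mem_ratInterval.1 hn
  rw [abs_le] at h ⊢
  rw [abs_lt] at h2
  constructor <;> linarith

end Cut

/-! ### Approximation by rational combinations -/

section Dense

open Filter Topology

variable {𝕜 B : Type*} [RCLike 𝕜] [NormedAddCommGroup B] [NormedSpace 𝕜 B] {σ : ℕ → 𝕜}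

theorem continuous_linComb (σ : ℕ → 𝕜) (l : List ℕ) :
    Continuous fun x : ℕ → B => linComb σ x l := by
  unfold linComb
  fun_prop

theorem linComb_congr {x y : ℕ → B} {l : List ℕ} (h : ∀ j < l.length, x j = y j) :
    linComb σ x l = linComb σ y l :=
  Finset.sum_congr rfl fun j hj => by rw [h j (Finset.mem_range.1 hj)]

theorem linComb_map_range (x : ℕ → B) (s : ℕ → ℕ) (M : ℕ) :
    linComb σ x ((List.range M).map s) = ∑ j ∈ Finset.range M, σ (s j) • x j := by
  refine Finset.sum_congr (by simp) fun j hj => ?_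
  have : j < M := by simpa using hj
  rw [List.getD_eq_getElem _ _ (by simpa using this)]
  simp

/-- Each vector of a sequence is a coded linear combination of the sequence. -/
theorem ScalarCoding.exists_linComb_eq (C : ScalarCoding σ) (j : ℕ) :
    ∃ l : List ℕ, ∀ x : ℕ → B, linComb σ x l = x j := by
  refine ⟨(List.range (j + 1)).map fun i => if i = j then C.one else 0, fun x => ?_⟩
  rw [linComb_map_range, Finset.sum_eq_single j]
  · simp [C.map_one]
  · intro i _ hij
    simp [hij, C.map_zero]
  · simp

/-- A vector of the span involves finitely many coefficients and depends continuously on them, so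
coded scalars approximate it. -/
theorem ScalarCoding.denseRange_linComb (C : ScalarCoding σ) {x : ℕ → B}
    (hx : (Submodule.span 𝕜 (Set.range x)).topologicalClosure = ⊤) :
    DenseRange fun l : List ℕ => linComb σ x l := by
  have hsub : (Submodule.span 𝕜 (Set.range x) : Set B) ⊆
      closure (Set.range fun l : List ℕ => linComb σ x l) := by
    intro y hy
    obtain ⟨c, rfl⟩ := Finsupp.mem_span_range_iff_exists_finsupp.1 hy
    obtain ⟨M, hM⟩ := c.support.exists_nat_subset_range
    have hc : (c.sum fun i a => a • x i) = ∑ j ∈ Finset.range M, c j • x j :=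
      Finset.sum_subset hM fun j _ hj => by
        simp [Finsupp.notMem_support_iff.1 hj]
    have hcont : Continuous fun a : ℕ → 𝕜 => ∑ j ∈ Finset.range M, a j • x j := by fun_prop
    have hd : DenseRange (Pi.map fun _ : ℕ => σ) := DenseRange.piMap fun _ => C.dense
    rw [hc]
    refine closure_mono ?_
      (image_closure_subset_closure_image hcont (Set.mem_image_of_mem _ (hd (c : ℕ → 𝕜))))
    rintro _ ⟨_, ⟨s, rfl⟩, rfl⟩
    exact ⟨(List.range M).map s, linComb_map_range x s M⟩
  intro y
  refine closure_minimal hsub isClosed_closure ?_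
  rw [← Submodule.topologicalClosure_coe, hx]
  trivial

theorem isOpen_mem_seqDiagram (σ : ℕ → 𝕜) (k : ℕ) :
    IsOpen {x : ℕ → B | k ∈ seqDiagram σ x} :=
  Metric.isOpen_ball.preimage (continuous_linComb σ _).norm

/-- Finitely many elements of the diagram of a sequence can be realized with rational
combinations of a linearly dense sequence. -/
theorem ScalarCoding.exists_comb (C : ScalarCoding σ) {x e : ℕ → B}
    (he : (Submodule.span 𝕜 (Set.range e)).topologicalClosure = ⊤) (L : Finset ℕ)
    (hL : ∀ k ∈ L, k ∈ seqDiagram σ x) :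
    ∃ W, ∀ k ∈ L, C.combCode W k ∈ seqDiagram σ e := by
  have hd : DenseRange (Pi.map fun (_ : ℕ) (l : List ℕ) => linComb σ e l) :=
    DenseRange.piMap fun _ => C.denseRange_linComb he
  -- Finitely many diagram conditions define an open set in the product topology, so it meets the
  -- dense set of sequences of rational combinations of `e`.
  obtain ⟨s, hs⟩ := hd.exists_mem_open (s := ⋂ k ∈ L, {y : ℕ → B | k ∈ seqDiagram σ y})
    (isOpen_biInter_finset fun k _ => isOpen_mem_seqDiagram σ k)
    ⟨x, by simpa using hL⟩
  simp only [Set.mem_iInter] at hs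
  -- The conditions in `L` see only the first `J` vectors, so the infinite choice `s` can be cut
  -- down to a finite list.
  let J := L.sup fun k => (Denumerable.ofNat (List ℕ) k.unpair.1).length
  refine ⟨(List.range J).map s, fun k hk => (C.combCode_mem_seqDiagram _ _ _).2 ?_⟩
  have h := hs k hk
  have hJ : (Denumerable.ofNat (List ℕ) k.unpair.1).length ≤ J :=
    Finset.le_sup (f := fun k : ℕ => (Denumerable.ofNat (List ℕ) k.unpair.1).length) hk
  change _ ∈ ratInterval _ at h ⊢
  convert h using 2
  refine linComb_congr fun j hj => ?_
  rw [List.getD_eq_getElem _ _ (by simpa using hj.trans_le hJ)]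
  simp [Pi.map]

end Dense

/-! ### Ultralimits of approximate realizations -/

section Limit

open Filter Topology

universe u

variable {𝕜 : Type u} {X : Type*} [RCLike 𝕜] {σ : ℕ → 𝕜} {D : Set ℕ}

section

variable [NormedAddCommGroup X] [NormedSpace 𝕜 X]

/-- The vector `w s j` is itself a rational vector, and the cut contains an interval for its norm.
-/
theorem IsCut.exists_bound (hD : IsCut D) (C : ScalarCoding σ) {U : Filter ℕ}
    {w : ℕ → ℕ → X} (hw : ∀ k ∈ D, ∀ᶠ s in U, k ∈ seqDiagram σ (w s)) (j : ℕ) :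
    ∃ R, ∀ᶠ s in U, ‖w s j‖ ≤ R := by
  obtain ⟨l, hl⟩ := C.exists_linComb_eq (B := X) j
  obtain ⟨k, hk, hkl, -⟩ := hD.precise (Encodable.encode l) 0
  refine ⟨posRatOfCode k.unpair.2.unpair.2 + ratOfCode k.unpair.2.unpair.1,
    (hw k hk).mono fun s hs => ?_⟩
  have h := (abs_lt.1 (mem_ratInterval.1 hs)).2
  rw [hkl, Denumerable.ofNat_encode, hl] at h
  exact (sub_lt_iff_lt_add.1 h).le

theorem abs_sub_le_of_tendsto {U : Filter ℕ} [U.NeBot] {w : ℕ → ℕ → X} {k : ℕ} {r : ℝ}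
    (hw : ∀ᶠ s in U, k ∈ seqDiagram σ (w s))
    (hr : Tendsto (fun s => ‖linComb σ (w s) (Denumerable.ofNat (List ℕ) k.unpair.1)‖) U (𝓝 r)) :
    |r - ratOfCode k.unpair.2.unpair.1| ≤ (posRatOfCode k.unpair.2.unpair.2 : ℝ) :=
  le_of_tendsto (hr.sub_const _).abs (hw.mono fun _ hs => (mem_ratInterval.1 hs).le)

/-- In a proper space, sequences that approximately realize a cut have a limit that realizes it. -/
theorem IsCut.exists_of_properSpace [ProperSpace X] (hD : IsCut D) (C : ScalarCoding σ)
    {w : ℕ → ℕ → X} (hw : ∀ k ∈ D, ∀ᶠ s in atTop, k ∈ seqDiagram σ (w s)) :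
    ∃ x : ℕ → X, ∀ k ∈ D, |‖linComb σ x (Denumerable.ofNat (List ℕ) k.unpair.1)‖ -
      ratOfCode k.unpair.2.unpair.1| ≤ (posRatOfCode k.unpair.2.unpair.2 : ℝ) := by
  -- Along a nonprincipal ultrafilter all bounded coordinates converge at once, without extracting a
  -- diagonal subsequence.
  have hw' : ∀ k ∈ D, ∀ᶠ s in (hyperfilter ℕ : Filter ℕ), k ∈ seqDiagram σ (w s) :=
    fun k hk => Nat.hyperfilter_le_atTop (hw k hk)
  have hx (j : ℕ) : ∃ y, Tendsto (fun s => w s j) (hyperfilter ℕ) (𝓝 y) := by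
    obtain ⟨R, hR⟩ := hD.exists_bound C hw' j
    obtain ⟨y, -, hy⟩ := (isCompact_closedBall (0 : X) R).ultrafilter_le_nhds
      ((hyperfilter ℕ).map fun s => w s j) (by
        rw [le_principal_iff]
        exact hR.mono fun s hs => by simpa using hs)
    exact ⟨y, hy⟩
  choose x hx using hx
  refine ⟨x, fun k hk => abs_sub_le_of_tendsto (hw' k hk) ?_⟩
  exact (((continuous_linComb σ _).tendsto x).comp (tendsto_pi_nhds.2 hx)).norm

end

/-- Sequences of vectors in an inner product space that approximately realize a cut have a limit in
some Hilbert space that realizes it. -/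
theorem IsCut.exists_hilbertSpace [NormedAddCommGroup X] [InnerProductSpace 𝕜 X]
    (hD : IsCut D) (C : ScalarCoding σ)
    {w : ℕ → ℕ → X} (hw : ∀ k ∈ D, ∀ᶠ s in atTop, k ∈ seqDiagram σ (w s)) :
    ∃ (H : Type u) (_ : NormedAddCommGroup H) (_ : InnerProductSpace 𝕜 H) (_ : CompleteSpace H)
      (x : ℕ → H), (Submodule.span 𝕜 (Set.range x)).topologicalClosure = ⊤ ∧
      ∀ k ∈ D, |‖linComb σ x (Denumerable.ofNat (List ℕ) k.unpair.1)‖ -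
        ratOfCode k.unpair.2.unpair.1| ≤ (posRatOfCode k.unpair.2.unpair.2 : ℝ) := by
  have hw' : ∀ k ∈ D, ∀ᶠ s in (hyperfilter ℕ : Filter ℕ), k ∈ seqDiagram σ (w s) :=
    fun k hk => Nat.hyperfilter_le_atTop (hw k hk)
  -- The limit space is built on formal combinations, evaluated at stage `s` by `T s`; the vectors
  -- `w s j` need not converge, but their inner products do.
  let T : ℕ → (ℕ →₀ 𝕜) →ₗ[𝕜] X := fun s => Finsupp.linearCombination 𝕜 (w s)
  have hT (a : ℕ →₀ 𝕜) : ∃ R, ∀ᶠ s in (hyperfilter ℕ : Filter ℕ), ‖T s a‖ ≤ R := by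
    induction a using Finsupp.induction_linear with
    | zero => exact ⟨0, by simp⟩
    | add a b ha hb =>
      obtain ⟨R, hR⟩ := ha
      obtain ⟨R', hR'⟩ := hb
      refine ⟨R + R', ?_⟩
      filter_upwards [hR, hR'] with s h h'
      rw [map_add]
      exact (norm_add_le _ _).trans (add_le_add h h')
    | single j c =>
      obtain ⟨R, hR⟩ := hD.exists_bound C hw' j
      refine ⟨‖c‖ * R, hR.mono fun s hs => ?_⟩
      simp only [T, Finsupp.linearCombination_single, norm_smul]
      gcongr
  have hip (a b : ℕ →₀ 𝕜) :
      ∃ z, Tendsto (fun s => inner 𝕜 (T s a) (T s b)) (hyperfilter ℕ) (𝓝 z) := by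
    obtain ⟨R, hR⟩ := hT a
    obtain ⟨R', hR'⟩ := hT b
    obtain ⟨y, -, hy⟩ := (isCompact_closedBall (0 : 𝕜) (R * R')).ultrafilter_le_nhds
      ((hyperfilter ℕ).map fun s => inner 𝕜 (T s a) (T s b)) (by
        rw [le_principal_iff]
        change ∀ᶠ s in (hyperfilter ℕ : Filter ℕ), inner 𝕜 (T s a) (T s b) ∈ _
        filter_upwards [hR, hR'] with s h h'
        rw [mem_closedBall_zero_iff]
        exact (norm_inner_le_norm _ _).trans
          (mul_le_mul h h' (norm_nonneg _) ((norm_nonneg _).trans h)))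
    exact ⟨y, hy⟩
  choose ip hip using hip
  -- The limit form may be degenerate; the completion below also identifies vectors at distance
  -- zero.
  let core : PreInnerProductSpace.Core 𝕜 (ℕ →₀ 𝕜) :=
    { inner := ip
      conj_inner_symm := fun a b => tendsto_nhds_unique
        ((RCLike.continuous_conj.tendsto _).comp (hip b a))
        ((hip a b).congr fun s => (inner_conj_symm _ _).symm)
      re_inner_nonneg := fun a => ge_of_tendsto'
        ((RCLike.continuous_re.tendsto _).comp (hip a a)) fun s => inner_self_nonneg
      add_left := fun a b c => tendsto_nhds_unique (hip (a + b) c)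
        (((hip a c).add (hip b c)).congr fun s => by rw [map_add, inner_add_left])
      smul_left := fun a b c => tendsto_nhds_unique (hip (c • a) b)
        (((hip a b).const_mul _).congr fun s => by rw [map_smul, inner_smul_left]) }
  let : SeminormedAddCommGroup (ℕ →₀ 𝕜) :=
    InnerProductSpace.Core.toSeminormedAddCommGroup (𝕜 := 𝕜)
  let : InnerProductSpace 𝕜 (ℕ →₀ 𝕜) := InnerProductSpace.ofCore core
  have hnorm (a : ℕ →₀ 𝕜) : Tendsto (fun s => ‖T s a‖) (hyperfilter ℕ) (𝓝 ‖a‖) := by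
    have h1 : ‖a‖ = √(RCLike.re (ip a a)) := rfl
    rw [h1]
    refine (((RCLike.continuous_re.tendsto _).comp (hip a a)).sqrt).congr fun s => ?_
    exact (norm_eq_sqrt_re_inner _).symm
  let ι : (ℕ →₀ 𝕜) →L[𝕜] UniformSpace.Completion (ℕ →₀ 𝕜) := UniformSpace.Completion.toComplL
  let x : ℕ → UniformSpace.Completion (ℕ →₀ 𝕜) := fun j => ι (Finsupp.single j 1)
  refine ⟨UniformSpace.Completion (ℕ →₀ 𝕜), inferInstance, inferInstance, inferInstance, x,
    ?_, fun k hk => ?_⟩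
  · have hspan : (Submodule.span 𝕜 (Set.range x) : Set _) = Set.range ι := by
      have : Set.range x = ι.toLinearMap '' Set.range fun j : ℕ => Finsupp.single j (1 : 𝕜) := by
        rw [← Set.range_comp]; rfl
      rw [this, Submodule.span_image]
      have htop : Submodule.span 𝕜 (Set.range fun j : ℕ => Finsupp.single j (1 : 𝕜)) = ⊤ := by
        have := (Finsupp.basisSingleOne (R := 𝕜) (ι := ℕ)).span_eq
        simpa using this
      rw [htop, Submodule.map_top]
      exact LinearMap.coe_range _
    rw [Submodule.eq_top_iff']
    intro y
    rw [← SetLike.mem_coe, Submodule.topologicalClosure_coe, hspan]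
    exact UniformSpace.Completion.denseRange_coe y
  · set l := Denumerable.ofNat (List ℕ) k.unpair.1 with hl
    let a : ℕ →₀ 𝕜 := ∑ j ∈ Finset.range l.length, σ (l.getD j 0) • Finsupp.single j 1
    have h1 : linComb σ x l = ι a := by simp only [linComb, x, a, map_sum, map_smul]
    have h2 (s : ℕ) : T s a = linComb σ (w s) l := by
      simp only [linComb, a, T, map_sum, map_smul, Finsupp.linearCombination_single, one_smul]
    have h3 : ‖ι a‖ = ‖a‖ := UniformSpace.Completion.norm_coe a
    rw [h1, h3]
    exact abs_sub_le_of_tendsto (hw' k hk) ((hnorm a).congr fun s => by rw [h2])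

end Limit

/-! ### Recognizing the Hilbert space -/

section Recognition

open Filter Topology

universe u

variable {𝕜 : Type u} [RCLike 𝕜] {σ : ℕ → 𝕜}

section

variable {B K : Type*} [NormedAddCommGroup B] [NormedSpace 𝕜 B] [NormedAddCommGroup K]
  [NormedSpace 𝕜 K]

/-- If the diagram of `e` is approximately realized by rational combinations of `x`, in a proper
space, then there is an isometric copy of `e`. -/
theorem ScalarCoding.exists_isometric_copy [ProperSpace K] (C : ScalarCoding σ) {e : ℕ → B}
    {x : ℕ → K}
    (h : ∀ t, ∃ W, ∀ k < t, k ∈ seqDiagram σ e → C.combCode W k ∈ seqDiagram σ x) :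
    ∃ u : ℕ → K, ∀ l, ‖linComb σ u l‖ = ‖linComb σ e l‖ := by
  choose W hW using h
  obtain ⟨u, hu⟩ := (isCut_seqDiagram (σ := σ) e).exists_of_properSpace C
    (w := fun t j => linComb σ x ((W t).getD j [])) fun k hk =>
      (eventually_gt_atTop k).mono fun t ht => (C.combCode_mem_seqDiagram _ _ _).1 (hW t k ht hk)
  exact ⟨u, norm_linComb_eq hu⟩

/-- Both norms are continuous in the coefficients and agree on the dense set of coded ones. -/
theorem ScalarCoding.norm_sum_eq (C : ScalarCoding σ) {e : ℕ → B} {u : ℕ → K}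
    (hu : ∀ l, ‖linComb σ u l‖ = ‖linComb σ e l‖) (M : ℕ) (a : ℕ → 𝕜) :
    ‖∑ j ∈ Finset.range M, a j • u j‖ = ‖∑ j ∈ Finset.range M, a j • e j‖ := by
  have hd : DenseRange (Pi.map fun _ : ℕ => σ) := DenseRange.piMap fun _ => C.dense
  have hcu : Continuous fun a : ℕ → 𝕜 => ‖∑ j ∈ Finset.range M, a j • u j‖ := by fun_prop
  have hce : Continuous fun a : ℕ → 𝕜 => ‖∑ j ∈ Finset.range M, a j • e j‖ := by fun_prop
  refine congrFun (hd.equalizer hcu hce (funext fun s => ?_)) a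
  have := hu ((List.range M).map s)
  rwa [linComb_map_range, linComb_map_range] at this

/-- A space with an isometric copy of an orthonormal sequence of length `M` has dimension at
least `M`. -/
theorem ScalarCoding.le_finrank [FiniteDimensional 𝕜 K] (C : ScalarCoding σ) {e : ℕ → B} {x : ℕ → K}
    {cut : ℕ → ℕ} (he : ∀ (M : ℕ) (a : ℕ → 𝕜),
      ‖∑ j ∈ Finset.range M, a j • e j‖ ^ 2 = ∑ j ∈ Finset.range (cut M), ‖a j‖ ^ 2)
    (h : ∀ t, ∃ W, ∀ k < t, k ∈ seqDiagram σ e → C.combCode W k ∈ seqDiagram σ x)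
    {M : ℕ} (hM : cut M = M) : M ≤ Module.finrank 𝕜 K := by
  have : ProperSpace K := FiniteDimensional.proper_rclike 𝕜 K
  obtain ⟨u, hu⟩ := C.exists_isometric_copy h
  have hli : LinearIndependent 𝕜 fun i : Fin M => u i := by
    rw [Fintype.linearIndependent_iff]
    intro g hg i
    let a : ℕ → 𝕜 := fun j => if h : j < M then g ⟨j, h⟩ else 0
    have ha (i : Fin M) : a i = g i := by simp [a]
    have h1 : ∑ j ∈ Finset.range M, a j • u j = 0 := by
      rw [Finset.sum_range, ← hg]
      simp only [ha]
    have h2 := he M a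
    -- A vanishing combination of the copy gives a vanishing sum of squares of all `M` coefficients,
    -- because `cut M = M`.
    rw [← C.norm_sum_eq hu, h1, norm_zero, zero_pow two_ne_zero, hM, eq_comm,
      Finset.sum_eq_zero_iff_of_nonneg fun _ _ => by positivity] at h2
    simpa [ha] using h2 i (by simp)
  simpa using hli.fintype_card_le_finrank

/-- The predicate `p` marks the unit vectors; the others are zero. This treats an orthonormal
sequence and a finite basis padded with zeros together. -/
theorem norm_sum_sq_of_inner_eq {V : Type*} [NormedAddCommGroup V] [InnerProductSpace 𝕜 V]
    {e : ℕ → V} {p : ℕ → Prop} [DecidablePred p]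
    (he : ∀ i j, inner 𝕜 (e i) (e j) = if i = j ∧ p i then (1 : 𝕜) else 0) (s : Finset ℕ)
    (a : ℕ → 𝕜) : ‖∑ j ∈ s, a j • e j‖ ^ 2 = ∑ j ∈ s with p j, ‖a j‖ ^ 2 := by
  have h : inner 𝕜 (∑ j ∈ s, a j • e j) (∑ j ∈ s, a j • e j) =
      ∑ j ∈ s with p j, ((‖a j‖ ^ 2 : ℝ) : 𝕜) := by
    rw [sum_inner, Finset.sum_filter]
    refine Finset.sum_congr rfl fun i hi => ?_
    rw [inner_sum, Finset.sum_eq_single i]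
    · rw [inner_smul_left, inner_smul_right, he]
      by_cases hp : p i
      · simp [hp, RCLike.conj_mul]
      · simp [hp]
    · intro j _ hji
      rw [inner_smul_left, inner_smul_right, he, if_neg fun h => hji h.1.symm]
      simp
    · exact fun h => absurd hi h
  rw [norm_sq_eq_re_inner (𝕜 := 𝕜), h]
  simp only [← RCLike.ofReal_sum, RCLike.ofReal_re]

end

/-- An infinite-dimensional Hilbert space with a linearly dense sequence is isometric to `ℓ²`. -/
theorem nonempty_linearIsometryEquiv_lp {H : Type*} [NormedAddCommGroup H] [InnerProductSpace 𝕜 H]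
    [CompleteSpace H] {x : ℕ → H}
    (hx : (Submodule.span 𝕜 (Set.range x)).topologicalClosure = ⊤)
    (hinf : ¬ FiniteDimensional 𝕜 H) : Nonempty (H ≃ₗᵢ[𝕜] lp (fun _ : ℕ => 𝕜) 2) := by
  obtain ⟨w, b, hb⟩ := exists_hilbertBasis 𝕜 H
  -- By density each basis vector has a nonzero inner product with some `x j`, and by Bessel's
  -- inequality each `x j` has only countably many such partners.
  have hcount : Countable w := by
    have h1 (i : w) : ∃ j, inner 𝕜 (b i) (x j) ≠ 0 := by
      by_contra! h
      have h2 : b i ∈ (Submodule.span 𝕜 (Set.range x)).topologicalClosureᗮ := by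
        rw [Submodule.orthogonal_closure, Submodule.mem_orthogonal']
        intro y hy
        induction hy using Submodule.span_induction with
        | mem y hy => obtain ⟨j, rfl⟩ := hy; exact h j
        | zero => exact inner_zero_right _
        | add y z _ _ hy hz => rw [inner_add_right, hy, hz, add_zero]
        | smul c y _ hy => rw [inner_smul_right, hy, mul_zero]
      rw [hx, Submodule.top_orthogonal_eq_bot, Submodule.mem_bot] at h2
      exact b.orthonormal.ne_zero i h2
    have h3 (j : ℕ) : {i : w | inner 𝕜 (b i) (x j) ≠ 0}.Countable := by
      have := (b.orthonormal.inner_products_summable (x := x j)).countable_support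
      refine this.mono fun i hi => ?_
      simpa using hi
    rw [← Set.countable_univ_iff]
    refine (Set.countable_iUnion h3).mono fun i _ => ?_
    simpa using h1 i
  have hinf' : Infinite w := by
    by_contra hfin
    rw [not_infinite_iff_finite] at hfin
    have := Fintype.ofFinite w
    exact hinf b.toOrthonormalBasis.toBasis.finiteDimensional_of_finite
  obtain ⟨e⟩ := nonempty_equiv_of_countable (α := ℕ) (β := w)
  have ho : Orthonormal 𝕜 (b ∘ e) := b.orthonormal.comp e e.injective
  exact ⟨(HilbertBasis.mk ho (by
    rw [Set.range_comp, e.range_eq_univ, Set.image_univ, b.dense_span])).repr⟩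

/-- Transport of a linearly dense sequence along an isometry. -/
theorem span_range_comp_topologicalClosure {H B : Type*} [NormedAddCommGroup H] [NormedSpace 𝕜 H]
    [NormedAddCommGroup B] [NormedSpace 𝕜 B] (φ : H ≃ₗᵢ[𝕜] B) {x : ℕ → H}
    (hx : (Submodule.span 𝕜 (Set.range x)).topologicalClosure = ⊤) :
    (Submodule.span 𝕜 (Set.range (φ ∘ x))).topologicalClosure = ⊤ := by
  have h1 : Submodule.span 𝕜 (Set.range (φ ∘ x)) =
      (Submodule.span 𝕜 (Set.range x)).map φ.toLinearEquiv.toLinearMap := by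
    rw [← Submodule.span_image, Set.range_comp]; rfl
  rw [← Submodule.dense_iff_topologicalClosure_eq_top] at hx ⊢
  rw [h1]
  exact φ.surjective.denseRange.dense_image φ.continuous hx

theorem seqDiagram_comp {H B : Type*} [NormedAddCommGroup H] [NormedSpace 𝕜 H]
    [NormedAddCommGroup B] [NormedSpace 𝕜 B] (φ : H ≃ₗᵢ[𝕜] B) (x : ℕ → H) :
    seqDiagram σ (φ ∘ x) = seqDiagram σ x := by
  have (l : List ℕ) : ‖linComb σ (φ ∘ x) l‖ = ‖linComb σ x l‖ := by
    rw [← φ.norm_map (linComb σ x l)]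
    simp [linComb]
  simp only [seqDiagram, this]

theorem ScalarCoding.eventually_mem (C : ScalarCoding σ) {B : Type*} [NormedAddCommGroup B]
    [NormedSpace 𝕜 B] {e : ℕ → B} {f : ℕ → ℕ} {W : ℕ → List (List ℕ)}
    (hW : ∀ t, ∀ i < t, C.combCode (W t) (f i) ∈ seqDiagram σ e) :
    ∀ k ∈ Set.range f, ∀ᶠ t in atTop,
      k ∈ seqDiagram σ fun j => linComb σ e ((W t).getD j []) := by
  rintro _ ⟨i, rfl⟩
  exact (eventually_gt_atTop i).mono fun t ht => (C.combCode_mem_seqDiagram _ _ _).1 (hW t i ht)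

/-- `hB` produces a Hilbert space generated by a sequence with diagram `Set.range f`; `hC` forces
its dimension to be infinite, which determines it up to isometry. -/
theorem ScalarCoding.exists_presentation_lp (C : ScalarCoding σ) {e : ℕ → lp (fun _ : ℕ => 𝕜) 2}
    (he : ∀ (M : ℕ) (a : ℕ → 𝕜),
      ‖∑ j ∈ Finset.range M, a j • e j‖ ^ 2 = ∑ j ∈ Finset.range M, ‖a j‖ ^ 2)
    {f : ℕ → ℕ} (hf : IsCut (Set.range f))
    (hB : ∀ t, ∃ W, ∀ i < t, C.combCode W (f i) ∈ seqDiagram σ e)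
    (hC : ∀ t, ∃ W, ∀ k < t, k ∈ seqDiagram σ e → C.combCode W k ∈ Set.range f) :
    ∃ S : Presentation 𝕜 (lp (fun _ : ℕ => 𝕜) 2), S.IsName σ f := by
  choose W hW using hB
  obtain ⟨H, _, _, _, x, hx, hfx⟩ := hf.exists_hilbertSpace C (C.eventually_mem hW)
  have hD := hf.eq_seqDiagram hfx
  rw [hD] at hC
  have hinf : ¬ FiniteDimensional 𝕜 H := fun _ =>
    Nat.not_succ_le_self _ (C.le_finrank (cut := id) he hC
      (M := Module.finrank 𝕜 H + 1) rfl)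
  obtain ⟨φ⟩ := nonempty_linearIsometryEquiv_lp hx hinf
  exact ⟨⟨φ ∘ x, span_range_comp_topologicalClosure φ hx⟩, hD.trans (seqDiagram_comp φ x).symm⟩

/-- Compactness keeps the limit sequence inside `𝕜ⁿ`, so the dimension is at most `n`; `hC` makes
its span `n`-dimensional. -/
theorem ScalarCoding.exists_presentation_finite (C : ScalarCoding σ) {n : ℕ}
    {e : ℕ → EuclideanSpace 𝕜 (Fin n)}
    (he : ∀ (M : ℕ) (a : ℕ → 𝕜),
      ‖∑ j ∈ Finset.range M, a j • e j‖ ^ 2 = ∑ j ∈ Finset.range (min M n), ‖a j‖ ^ 2)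
    {f : ℕ → ℕ} (hf : IsCut (Set.range f))
    (hB : ∀ t, ∃ W, ∀ i < t, C.combCode W (f i) ∈ seqDiagram σ e)
    (hC : ∀ t, ∃ W, ∀ k < t, k ∈ seqDiagram σ e → C.combCode W k ∈ Set.range f) :
    ∃ S : Presentation 𝕜 (EuclideanSpace 𝕜 (Fin n)), S.IsName σ f := by
  choose W hW using hB
  have : ProperSpace (EuclideanSpace 𝕜 (Fin n)) := FiniteDimensional.proper_rclike 𝕜 _
  obtain ⟨x, hfx⟩ := hf.exists_of_properSpace C (C.eventually_mem hW)
  have hD := hf.eq_seqDiagram hfx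
  -- The dimension count has to take place in the span of `x`, which contains all its rational
  -- vectors.
  let K := Submodule.span 𝕜 (Set.range x)
  let y : ℕ → K := fun j => ⟨x j, Submodule.subset_span ⟨j, rfl⟩⟩
  have hxy : seqDiagram σ x = seqDiagram σ y := by
    have (l : List ℕ) : ‖linComb σ y l‖ = ‖linComb σ x l‖ := by
      change ‖K.subtype (linComb σ y l)‖ = _
      simp [linComb, y]
    simp only [seqDiagram, this]
  rw [hD, hxy] at hC
  have hle := C.le_finrank he hC (M := n) (min_self n)
  have hK : K = ⊤ := Submodule.eq_top_of_finrank_eq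
    (le_antisymm (Submodule.finrank_le K) (by simpa using hle))
  exact ⟨⟨x, top_le_iff.1 (hK.symm.le.trans (Submodule.le_topologicalClosure _))⟩, hD⟩

end Recognition

/-! ### Complexity of the conditions and completeness -/

section Complexity

variable {𝕜 B : Type*} [RCLike 𝕜] [NormedAddCommGroup B] [NormedSpace 𝕜 B] {σ : ℕ → 𝕜}

/-- Elements of the range are quantified through their indices, and `Refines` is decidable, so each
clause asks for one sufficiently long prefix. The length conditions keep the default value of `getD`
from being read. -/
theorem isPi02_isCut_range : IsPi02 {f | IsCut (Set.range f)} := by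
  have h1 : IsPi02 {f : ℕ → ℕ | ∀ x : ℕ × ℕ, ∃ (s : ℕ) (_ : ℕ), ∃ k ∈ (List.range s).map f,
      k.unpair.1 = x.1 ∧ ratOfCode (ofPos k.unpair.2.unpair.2) < ratOfCode (ofPos x.2)} := by
    refine IsPi02.of_prefix (R := fun l (x : ℕ × ℕ) (_ : ℕ) => ∃ k ∈ l,
      k.unpair.1 = x.1 ∧ ratOfCode (ofPos k.unpair.2.unpair.2) < ratOfCode (ofPos x.2)) ?_
    refine PrimrecPred.bex_mem (R := fun (p : List ℕ × (ℕ × ℕ) × ℕ) (k : ℕ) =>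
      k.unpair.1 = p.2.1.1 ∧
        ratOfCode (ofPos k.unpair.2.unpair.2) < ratOfCode (ofPos p.2.1.2)) Primrec.fst ?_
    have hx : Primrec fun q : (List ℕ × (ℕ × ℕ) × ℕ) × ℕ => q.1.2.1 :=
      Primrec.fst.comp (Primrec.snd.comp Primrec.fst)
    exact (Primrec.eq.comp (primrec_unpair_fst.comp Primrec.snd) (Primrec.fst.comp hx)).and
      (primrecPred_lt (primrec_ofPos.comp (primrec_unpair_snd.comp
        (primrec_unpair_snd.comp Primrec.snd))) (primrec_ofPos.comp (Primrec.snd.comp hx)))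
  have h2 : IsPi02 {f : ℕ → ℕ | ∀ i : ℕ, ∃ (s : ℕ) (_ : ℕ), i < ((List.range s).map f).length ∧
      ∃ k ∈ (List.range s).map f, Refines k (((List.range s).map f).getD i 0)} := by
    refine IsPi02.of_prefix (R := fun l (i : ℕ) (_ : ℕ) => i < l.length ∧
      ∃ k ∈ l, Refines k (l.getD i 0)) ?_
    refine (Primrec.nat_lt.comp (Primrec.fst.comp Primrec.snd)
      (Primrec.list_length.comp Primrec.fst)).and ?_
    refine PrimrecPred.bex_mem (R := fun (p : List ℕ × ℕ × ℕ) (k : ℕ) =>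
      Refines k (p.1.getD p.2.1 0)) Primrec.fst ?_
    exact primrecRel_refines.comp Primrec.snd ((Primrec.list_getD 0).comp
      (Primrec.fst.comp Primrec.fst) (Primrec.fst.comp (Primrec.snd.comp Primrec.fst)))
  have h3 : IsPi02 {f : ℕ → ℕ | ∀ x : ℕ × ℕ, ∃ (s : ℕ) (_ : ℕ),
      x.1 < ((List.range s).map f).length ∧
      (¬ Refines (((List.range s).map f).getD x.1 0) x.2 ∨
        ∃ k ∈ (List.range s).map f, k = x.2)} := by
    refine IsPi02.of_prefix (R := fun l (x : ℕ × ℕ) (_ : ℕ) => x.1 < l.length ∧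
      (¬ Refines (l.getD x.1 0) x.2 ∨ ∃ k ∈ l, k = x.2)) ?_
    have hx : Primrec fun p : List ℕ × (ℕ × ℕ) × ℕ => p.2.1 := Primrec.fst.comp Primrec.snd
    refine (Primrec.nat_lt.comp (Primrec.fst.comp hx)
      (Primrec.list_length.comp Primrec.fst)).and (PrimrecPred.or ?_ ?_)
    · exact (primrecRel_refines.comp ((Primrec.list_getD 0).comp Primrec.fst
        (Primrec.fst.comp hx)) (Primrec.snd.comp hx) :).not
    · exact PrimrecPred.bex_mem (R := fun (p : List ℕ × (ℕ × ℕ) × ℕ) (k : ℕ) => k = p.2.1.2)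
        Primrec.fst (Primrec.eq.comp Primrec.snd (Primrec.snd.comp (hx.comp Primrec.fst)))
  have hget (f : ℕ → ℕ) {i s : ℕ} (h : i < s) : ((List.range s).map f).getD i 0 = f i := by
    simp [List.getD, h]
  convert (h1.inter h2).inter h3 using 1
  ext f
  simp only [Set.mem_inter_iff, Set.mem_ofPred_eq, List.mem_map, List.mem_range, List.length_map,
    List.length_range, exists_const, ratOfCode_ofPos]
  constructor
  · intro h
    refine ⟨⟨fun x => ?_, fun i => ?_⟩, fun x => ?_⟩
    · obtain ⟨_, ⟨i, rfl⟩, hk⟩ := h.precise x.1 x.2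
      exact ⟨i + 1, f i, ⟨i, by omega, rfl⟩, hk⟩
    · obtain ⟨_, ⟨j, rfl⟩, hk⟩ := h.rounded (f i) ⟨i, rfl⟩
      refine ⟨i + j + 1, by omega, f j, ⟨j, by omega, rfl⟩, ?_⟩
      rwa [hget f (by omega)]
    · by_cases hr : Refines (f x.1) x.2
      · obtain ⟨j, hj⟩ := h.upper (f x.1) ⟨x.1, rfl⟩ x.2 hr
        exact ⟨x.1 + j + 1, by omega, Or.inr ⟨f j, ⟨j, by omega, rfl⟩, hj⟩⟩
      · refine ⟨x.1 + 1, by omega, Or.inl ?_⟩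
        rwa [hget f (by omega)]
  · rintro ⟨⟨h1, h2⟩, h3⟩
    refine ⟨fun m p => ?_, ?_, ?_⟩
    · obtain ⟨s, _, ⟨i, -, rfl⟩, hk⟩ := h1 (m, p)
      exact ⟨f i, ⟨i, rfl⟩, hk⟩
    · rintro _ ⟨i, rfl⟩
      obtain ⟨s, hi, _, ⟨j, -, rfl⟩, hk⟩ := h2 i
      rw [hget f hi] at hk
      exact ⟨f j, ⟨j, rfl⟩, hk⟩
    · rintro _ ⟨i, rfl⟩ k' hk'
      obtain ⟨s, hi, h | ⟨_, ⟨j, -, rfl⟩, hk⟩⟩ := h3 (i, k')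
      · rw [hget f hi] at h
        exact absurd hk' h
      · exact ⟨j, hk⟩

theorem ScalarCoding.isPi02_forward (C : ScalarCoding σ) {D : Set ℕ}
    (hD : PrimrecPred fun k => k ∈ D) :
    IsPi02 {f | ∀ t, ∃ W, ∀ i < t, C.combCode W (f i) ∈ D} := by
  have h : IsPi02 {f : ℕ → ℕ | ∀ t : ℕ, ∃ (s : ℕ) (W : List (List ℕ)),
      ((List.range s).map f).length = t ∧ ∀ k ∈ (List.range s).map f, C.combCode W k ∈ D} := by
    refine IsPi02.of_prefix (R := fun l (t : ℕ) (W : List (List ℕ)) =>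
      l.length = t ∧ ∀ k ∈ l, C.combCode W k ∈ D) ?_
    refine (Primrec.eq.comp (Primrec.list_length.comp Primrec.fst)
      (Primrec.fst.comp Primrec.snd)).and ?_
    refine PrimrecPred.ball_mem (R := fun (p : List ℕ × ℕ × List (List ℕ)) (k : ℕ) =>
      C.combCode p.2.2 k ∈ D) Primrec.fst ?_
    exact hD.comp (C.primrec₂_combCode.comp
      (Primrec.snd.comp (Primrec.snd.comp Primrec.fst)) Primrec.snd)
  convert h using 1
  ext f
  simp

theorem ScalarCoding.isPi02_backward (C : ScalarCoding σ) {D : Set ℕ}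
    (hD : PrimrecPred fun k => k ∈ D) :
    IsPi02 {f | ∀ t, ∃ W, ∀ k < t, k ∈ D → C.combCode W k ∈ Set.range f} := by
  have h : IsPi02 {f : ℕ → ℕ | ∀ t : ℕ, ∃ (s : ℕ) (W : List (List ℕ)),
      ∀ k < t, ¬ k ∈ D ∨ ∃ i ∈ (List.range s).map f, i = C.combCode W k} := by
    refine IsPi02.of_prefix (R := fun l (t : ℕ) (W : List (List ℕ)) =>
      ∀ k < t, ¬ k ∈ D ∨ ∃ i ∈ l, i = C.combCode W k) ?_
    refine PrimrecPred.ball_lt (R := fun (p : List ℕ × ℕ × List (List ℕ)) (k : ℕ) =>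
      ¬ k ∈ D ∨ ∃ i ∈ p.1, i = C.combCode p.2.2 k) (Primrec.fst.comp Primrec.snd) ?_
    refine PrimrecPred.or (hD.comp Primrec.snd).not ?_
    refine PrimrecPred.bex_mem (R := fun (q : (List ℕ × ℕ × List (List ℕ)) × ℕ) (i : ℕ) =>
      i = C.combCode q.1.2.2 q.2) (Primrec.fst.comp Primrec.fst) ?_
    exact Primrec.eq.comp Primrec.snd (C.primrec₂_combCode.comp
      (Primrec.snd.comp (Primrec.snd.comp (Primrec.fst.comp Primrec.fst)))
      (Primrec.snd.comp Primrec.fst))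
  convert h using 1
  ext f
  simp only [Set.mem_ofPred_eq, List.mem_map, List.mem_range]
  refine forall_congr' fun t => ⟨?_, ?_⟩
  · rintro ⟨W, hW⟩
    choose! j hj using hW
    -- One prefix must contain the places of all the finitely many required codes.
    refine ⟨(Finset.range t).sup j + 1, W, fun k hk => ?_⟩
    by_cases hkD : k ∈ D
    · exact Or.inr ⟨_, ⟨j k, Nat.lt_succ_of_le
        (Finset.le_sup (f := j) (Finset.mem_range.2 hk)), rfl⟩, hj k hk hkD⟩
    · exact Or.inl hkD
  · rintro ⟨s, W, hW⟩
    refine ⟨W, fun k hk hkD => ?_⟩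
    obtain h | ⟨_, ⟨i, -, rfl⟩, hi⟩ := hW k hk
    · exact absurd hkD h
    · exact ⟨i, hi⟩

/-- Every rational vector contributes an entry. Hence a function with finite range names no
presentation, as the reduction requires. -/
theorem infinite_seqDiagram (x : ℕ → B) : (seqDiagram σ x).Infinite := by
  intro hfin
  have h := (isCut_seqDiagram (σ := σ) x).precise
  choose k hk hkm _ using fun m => h m 0
  refine Set.infinite_of_injective_forall_mem (f := k) (fun m m' hmm => ?_) hk hfin
  rw [← hkm m, ← hkm m', hmm]

/-- The names of the presentations of a Banach space with a presentation of decidable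
diagram are `Π⁰₂`-complete, if they are recognizable by approximate realizations. -/
theorem ScalarCoding.isPi02Complete_names (C : ScalarCoding σ) (E : Presentation 𝕜 B)
    (hE : PrimrecPred fun k => k ∈ seqDiagram σ E.point)
    (hrec : ∀ f : ℕ → ℕ, IsCut (Set.range f) →
      (∀ t, ∃ W, ∀ i < t, C.combCode W (f i) ∈ seqDiagram σ E.point) →
      (∀ t, ∃ W, ∀ k < t, k ∈ seqDiagram σ E.point → C.combCode W k ∈ Set.range f) →
      ∃ S : Presentation 𝕜 B, S.IsName σ f) :
    IsPi02Complete {f | ∃ S : Presentation 𝕜 B, S.IsName σ f} := by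
  classical
  constructor
  · convert (isPi02_isCut_range.inter (C.isPi02_forward hE)).inter (C.isPi02_backward hE) using 1
    ext f
    constructor
    · rintro ⟨S, hS⟩
      have hf : Set.range f = seqDiagram σ S.point := hS
      refine ⟨⟨?_, fun t => ?_⟩, fun t => ?_⟩
      · change IsCut _
        rw [hf]
        exact isCut_seqDiagram _
      · obtain ⟨W, hW⟩ := C.exists_comb (x := S.point) E.linearlyDense
          ((Finset.range t).image f) fun k hk => by
            obtain ⟨i, -, rfl⟩ := Finset.mem_image.1 hk
            rw [← hf]
            exact ⟨i, rfl⟩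
        exact ⟨W, fun i hi => hW _ (Finset.mem_image_of_mem f (Finset.mem_range.2 hi))⟩
      · obtain ⟨W, hW⟩ := C.exists_comb (x := E.point) S.linearlyDense
          ((Finset.range t).filter (· ∈ seqDiagram σ E.point)) fun k hk =>
            (Finset.mem_filter.1 hk).2
        refine ⟨W, fun k hk hkE => ?_⟩
        rw [hf]
        exact hW k (Finset.mem_filter.2 ⟨Finset.mem_range.2 hk, hkE⟩)
    · rintro ⟨⟨h1, h2⟩, h3⟩
      exact hrec f h1 h2 h3
  · intro P hP
    obtain ⟨F, hF, h1, h2⟩ := hP.exists_reduction hE (infinite_seqDiagram _).nonempty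
    refine ⟨F, hF, fun f => ⟨fun hf => ⟨E, h1 f hf⟩, ?_⟩⟩
    rintro ⟨S, hS⟩
    by_contra hf
    have hfin := h2 f hf
    rw [show Set.range (F f) = seqDiagram σ S.point from hS] at hfin
    exact infinite_seqDiagram _ hfin

theorem ScalarCoding.isPi02Complete_names_lp (C : ScalarCoding σ) :
    IsPi02Complete {f | ∃ S : Presentation 𝕜 (lp (fun _ : ℕ => 𝕜) 2), S.IsName σ f} := by
  let b : HilbertBasis ℕ 𝕜 (lp (fun _ : ℕ => 𝕜) 2) := ⟨LinearIsometryEquiv.refl 𝕜 _⟩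
  have he (M : ℕ) (a : ℕ → 𝕜) :
      ‖∑ j ∈ Finset.range M, a j • b j‖ ^ 2 = ∑ j ∈ Finset.range M, ‖a j‖ ^ 2 := by
    have := norm_sum_sq_of_inner_eq (e := b) (p := fun _ => True)
      (fun i j => by simpa using orthonormal_iff_ite.1 b.orthonormal i j) (Finset.range M) a
    simpa using this
  exact C.isPi02Complete_names ⟨b, b.dense_span⟩
    (C.primrecPred_seqDiagram (cut := id) Primrec.id he)
    fun f h1 h2 h3 => C.exists_presentation_lp he h1 h2 h3

theorem ScalarCoding.isPi02Complete_names_euclideanSpace (C : ScalarCoding σ) (n : ℕ) :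
    IsPi02Complete {f | ∃ S : Presentation 𝕜 (EuclideanSpace 𝕜 (Fin n)), S.IsName σ f} := by
  let b := EuclideanSpace.basisFun (Fin n) 𝕜
  -- A presentation is an infinite sequence, so the basis is continued by zeros; `min M n` of the
  -- first `M` vectors are nonzero.
  let e : ℕ → EuclideanSpace 𝕜 (Fin n) := fun j => if h : j < n then b ⟨j, h⟩ else 0
  have he (M : ℕ) (a : ℕ → 𝕜) :
      ‖∑ j ∈ Finset.range M, a j • e j‖ ^ 2 = ∑ j ∈ Finset.range (min M n), ‖a j‖ ^ 2 := by
    rw [norm_sum_sq_of_inner_eq (e := e) (p := fun i => i < n)]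
    · refine Finset.sum_congr ?_ fun _ _ => rfl
      ext j; simp
    · intro i j
      by_cases hi : i < n <;> by_cases hj : j < n
      · simp only [e, hi, hj, dite_true, and_true]
        rw [orthonormal_iff_ite.1 b.orthonormal]
        simp
      · have : i ≠ j := by rintro rfl; exact hj hi
        simp [e, hj, this]
      · simp [e, hi]
      · simp [e, hi]
  have hspan : (Submodule.span 𝕜 (Set.range e)).topologicalClosure = ⊤ := by
    refine top_le_iff.1 (le_trans ?_ (Submodule.le_topologicalClosure _))
    rw [← b.toBasis.span_eq, Submodule.span_le]
    rintro _ ⟨i, rfl⟩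
    exact Submodule.subset_span ⟨i, by simp [e]⟩
  exact C.isPi02Complete_names ⟨e, hspan⟩
    (C.primrecPred_seqDiagram (cut := fun M => min M n)
      (Primrec.nat_min.comp Primrec.id (Primrec.const n)) he)
    fun f h1 h2 h3 => C.exists_presentation_finite he h1 h2 h3

end Complexity

theorem mainTheorem6 :
    (IsPi02Complete (realNames (lp (fun _ : ℕ => ℝ) 2)) ∧
      ∀ n : ℕ, 1 ≤ n → IsPi02Complete (realNames (EuclideanSpace ℝ (Fin n)))) ∧
    (IsPi02Complete (complexNames (lp (fun _ : ℕ => ℂ) 2)) ∧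
      ∀ n : ℕ, 1 ≤ n → IsPi02Complete (complexNames (EuclideanSpace ℂ (Fin n)))) :=
  ⟨⟨realScalarCoding.isPi02Complete_names_lp,
    fun n _ => realScalarCoding.isPi02Complete_names_euclideanSpace n⟩,
    complexScalarCoding.isPi02Complete_names_lp,
    fun n _ => complexScalarCoding.isPi02Complete_names_euclideanSpace n⟩
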